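/- **Model.** Let $\mathcal S$ be a finite set and let $(S_t)_{t\ge 0}$ be a stationary, irreducible, aperiodic Markov chain on $\mathcal S$ with transition matrix $P$ and steady-state distribution $\pi$. For $t\ge 1$ let $\underline Z_t=(Z_{1,t},Z_{2,t})\in\{0,1\}^2$ be the erasure indicators at two receivers ($Z_{j,t}=1$ means that the packet sent in slot $t$ is erased at receiver $j$), drawn given the states independently according to a fixed conditional law $P_{\underline Z_t|S_t}$. Write $\epsilon_{12}(\underline z^{t-1})=P_{\underline Z_t|\underline Z^{t-1}}(1,1|\underline z^{t-1})$, and let $\epsilon_j(\underline z^{t-1})$ be the conditional probability of $\{Z_{j,t}=1\}$ given $\underline Z^{t-1}=\underline z^{t-1}$. For $n\ge1$ let $\bar{\mathcal C}_n$ be the closure of the set of pairs $(R_1,R_2)\ge 0$ for which there are $x(\underline z^{t-1}),y(\underline z^{t-1})\in[0,1]$, $t=1,\dots,n$, $\underline z^{t-1}\in\{0,1\}^{2(t-1)}$, with $$R_1\le \tfrac1n\sum_{t=1}^n\sum_{\underline z^{t-1}}P(\underline z^{t-1})(1-\epsilon_1(\underline z^{t-1}))\,x(\underline z^{t-1}),\qquad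 R_1\le \tfrac1n\sum_{t=1}^n\sum_{\underline z^{t-1}}P(\underline z^{t-1})(1-\epsilon_{12}(\underline z^{t-1}))(1-y(\underline z^{t-1})),$$ $$R_2\le \tfrac1n\sum_{t=1}^n\sum_{\underline z^{t-1}}P(\underline z^{t-1})(1-\epsilon_2(\underline z^{t-1}))\,y(\underline z^{t-1}),\qquad R_2\le \tfrac1n\sum_{t=1}^n\sum_{\underline z^{t-1}}P(\underline z^{t-1})(1-\epsilon_{12}(\underline z^{t-1}))(1-x(\underline z^{t-1})).$$ The hidden-state outer region is $\bar{\mathcal C}=\limsup_{n\to\infty}\bar{\mathcal C}_n=\bigcap_{N}\bigcup_{n\ge N}\bar{\mathcal C}_n$. **Queues.** For each flow $j\in\{1,2\}$ there are buffers $l=1,2,3$ with $Q^{(j)}_{l,t}\in\mathbb N_0$ packets at the beginning of slot $t\geq 1$, and an exit $l=4$ with $Q^{(j)}_{4,t}=0$. In slot $t$ an action $A_t\in\{1,\dots,5\}$ is chosen. With $\bar j$ the other receiver, the link capacities are $$C^{(j)}_{12,t}=\mathbf 1\{A_t=j\}Z_{j,t}(1-Z_{\bar j,t}),\quad C^{(j)}_{14,t}=\mathbf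 1\{A_t=j\}(1-Z_{j,t}),\quad C^{(j)}_{24,t}=\mathbf 1\{A_t=3\}(1-Z_{j,t}),$$ $$C^{(j)}_{13,t}=\mathbf 1\{A_t=4\}(1-Z_{1,t}Z_{2,t}),\quad C^{(j)}_{32,t}=\mathbf 1\{A_t=5\}Z_{j,t}(1-Z_{\bar j,t}),\quad C^{(j)}_{34,t}=\mathbf 1\{A_t=5\}(1-Z_{j,t}).$$ On the link $l\to m$ of flow $j$ travel $\mathbf 1\{Q^{(j)}_{l,t}>0\}\,E^{(j)}_{lm,t}\,C^{(j)}_{lm,t}$ packets, where $E^{(j)}_{lm,t}=\mathbf 1\{Q^{(j)}_{l,t}>Q^{(j)}_{m,t}\}$ is the link activation. In addition a new packet arrives in buffer $1$ of flow $j$ in each slot with probability $R_j$. The arrivals are independent over time and flows, and the initial queue state $\underline Q_1$, the channel $(S_t,\underline Z_t)_t$ and the arrivals are independent; $\underline Q_1$ has a finite second moment (for instance $\underline Q_1=0$). **Max-weight policy.** $A_t$ is a function of $\underline Q_t$ and $\underline Z^{t-1}$ such that, when $\underline Q_t=\underline q$ and $\underline Z^{t-1}=\underline z^{t-1}$, it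 maximizes over the actions $a\in\{1,\dots,5\}$ $$\sum_{j=1}^2\sum_{l\to m}\big[q^{(j)}_{l}-q^{(j)}_{m}\big]^+\;\mathbb E\big[C^{(j)}_{lm,t}\,\big|\,\underline Q_t=\underline q,\ \underline Z^{t-1}=\underline z^{t-1}\big],$$ where the inner sum is over the six links, $q^{(j)}_4=0$, and $C^{(j)}_{lm,t}$ is the capacity under $A_t=a$; ties are broken arbitrarily. **Theorem.** Let $R_1,R_2\ge0$ and $\delta>0$ with $(R_1+\delta,R_2+\delta)\in\bar{\mathcal C}$. Then under the max-weight policy all queues are strongly stable, that is, $$\limsup_{n\to\infty}\frac1n\sum_{t=1}^n\mathbb E\big[Q^{(j)}_{l,t}\big]<\infty\qquad\text{for } j\in\{1,2\},\ l\in\{1,2,3\}.$$ -/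

import Mathlib

open MeasureTheory ProbabilityTheory Filter

/-! ### The channel -/

/-- A feedback sample `(Z₁, Z₂)`: `z j = true` iff the packet is erased at receiver `j`
(receivers and their flows are indexed by `j : Fin 2`). -/
abbrev Feedback : Type := Fin 2 → Bool

/-- A broadcast packet erasure channel with memory: a finite irreducible aperiodic Markov chain
with transition matrix `P` and steady-state distribution `π`, and the conditional distribution
`W s` of the current erasure pattern given that the current state is `s`. -/
structure ErasureChannel (S : Type*) [Fintype S] [DecidableEq S] where
  P : Matrix S S ℝ
  P_stochastic : P ∈ Matrix.rowStochastic ℝ S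
  P_irreducible : P.IsIrreducible
  P_aperiodic : ∀ (s : S) (d : ℕ), (∀ k : ℕ, 0 < k → 0 < (P ^ k) s s → d ∣ k) → d = 1
  π : S → ℝ
  π_mem : π ∈ stdSimplex ℝ S
  π_stationary : Matrix.vecMul π P = π
  W : S → Feedback → ℝ
  W_mem : ∀ s, W s ∈ stdSimplex ℝ Feedback

namespace ErasureChannel

variable {S : Type*} [Fintype S] [DecidableEq S] (H : ErasureChannel S)

/-- The probability that the first `k` feedback samples are `z`, where the state sequence
`S₀, S₁, …` starts in steady state. The `i`-th entry of `z` is the sample at time `i + 1`. -/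
noncomputable def feedbackProb (k : ℕ) (z : Fin k → Feedback) : ℝ :=
  ∑ s : Fin (k + 1) → S,
    H.π (s 0) * ∏ i : Fin k, H.P (s i.castSucc) (s i.succ) * H.W (s i.succ) (z i)

/-- The conditional probability that the next feedback sample is `w`, given that the feedback
so far is `z`. -/
noncomputable def predict {k : ℕ} (z : Fin k → Feedback) (w : Feedback) : ℝ :=
  H.feedbackProb (k + 1) (Fin.snoc z w) / H.feedbackProb k z

/-- `ε₁₂(z)`: erasure at both receivers. -/
noncomputable def eps12 {k : ℕ} (z : Fin k → Feedback) : ℝ := H.predict z ![true, true]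

/-- `ε₁(z)`: erasure at the first receiver. -/
noncomputable def eps1 {k : ℕ} (z : Fin k → Feedback) : ℝ :=
  H.eps12 z + H.predict z ![true, false]

/-- `ε₂(z)`: erasure at the second receiver. -/
noncomputable def eps2 {k : ℕ} (z : Fin k → Feedback) : ℝ :=
  H.eps12 z + H.predict z ![false, true]

/-- The average over the slots `t = 1, …, n` of `∑_z P(z) g(z)`, where `z` runs over the
feedback sequences of length `t - 1`. -/
noncomputable def slotAverage (n : ℕ) (g : ∀ k : ℕ, (Fin k → Feedback) → ℝ) : ℝ :=
  (1 / (n : ℝ)) * ∑ k ∈ Finset.range n, ∑ z : Fin k → Feedback, H.feedbackProb k z * g k z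

/-- The `n`-slot region of rate pairs. -/
noncomputable def region (n : ℕ) : Set (ℝ × ℝ) :=
  closure {R | 0 ≤ R.1 ∧ 0 ≤ R.2 ∧ ∃ x y : ∀ k : ℕ, (Fin k → Feedback) → ℝ,
    (∀ k z, x k z ∈ Set.Icc (0 : ℝ) 1) ∧ (∀ k z, y k z ∈ Set.Icc (0 : ℝ) 1) ∧
    R.1 ≤ H.slotAverage n (fun k z => (1 - H.eps1 z) * x k z) ∧
    R.1 ≤ H.slotAverage n (fun k z => (1 - H.eps12 z) * (1 - y k z)) ∧
    R.2 ≤ H.slotAverage n (fun k z => (1 - H.eps2 z) * y k z) ∧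
    R.2 ≤ H.slotAverage n (fun k z => (1 - H.eps12 z) * (1 - x k z))}

/-- The outer region of the hidden case: the limit superior of the `n`-slot regions
(the rate pairs that lie in infinitely many of them). -/
noncomputable def outerRegion : Set (ℝ × ℝ) := limsup (fun n : ℕ => H.region n) atTop

end ErasureChannel

/-! ### The network of queues -/

/-- The three buffers that each of the two flows has at the transmitter. -/
inductive Buffer
  | one | two | three
  deriving DecidableEq

instance : Fintype Buffer := ⟨{.one, .two, .three}, fun l => by cases l <;> decide⟩

/-- The five actions: sending an uncoded packet for receiver `j` (actions 1 and 2), a coded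
packet (action 3), a poisoned packet (action 4), a remedy packet (action 5). -/
inductive SlotAction
  | uncoded (j : Fin 2) | coded | poison | remedy

/-- The links of the network of one flow. -/
inductive Link
  | l12 | l13 | l14 | l24 | l32 | l34
  deriving DecidableEq

instance : Fintype Link :=
  ⟨{.l12, .l13, .l14, .l24, .l32, .l34}, fun e => by cases e <;> decide⟩

/-- The buffer that a link leaves. -/
def Link.src : Link → Buffer
  | .l12 | .l13 | .l14 => .one
  | .l24 => .two
  | .l32 | .l34 => .three

/-- The buffer that a link enters; `none` is the exit, the (always empty) fourth buffer. -/
def Link.dst : Link → Option Buffer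
  | .l12 | .l32 => some .two
  | .l13 => some .three
  | .l14 | .l24 | .l34 => none

/-- The numbers of packets in the six buffers; `q j l` is buffer `l` of flow `j`. -/
abbrev QueueState : Type := Fin 2 → Buffer → ℕ

/-- The number of packets in a buffer of flow `j`, the exit included. -/
def level (q : QueueState) (j : Fin 2) (l : Option Buffer) : ℕ := l.elim 0 (q j)

/-- The capacity in `{0, 1}` of a link of flow `j` in a slot with action `a` and erasures `z`. -/
def capacity (j : Fin 2) (e : Link) (a : SlotAction) (z : Feedback) : ℕ :=
  match e, a with
  | .l12, .uncoded i => if i = j ∧ z j = true ∧ z j.rev = false then 1 else 0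
  | .l13, .poison => if z 0 = true ∧ z 1 = true then 0 else 1
  | .l14, .uncoded i => if i = j ∧ z j = false then 1 else 0
  | .l24, .coded => if z j = false then 1 else 0
  | .l32, .remedy => if z j = true ∧ z j.rev = false then 1 else 0
  | .l34, .remedy => if z j = false then 1 else 0
  | _, _ => 0

/-- The link activation of the max-weight policy: a link is used iff its differential backlog
is positive. -/
def activation (q : QueueState) (j : Fin 2) (e : Link) : ℕ :=
  if level q j e.dst < level q j (some e.src) then 1 else 0

/-- The number of packets that travel on a link of flow `j`. -/
def moved (q : QueueState) (a : SlotAction) (z : Feedback) (j : Fin 2) (e : Link) : ℕ :=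
  (if 0 < q j e.src then 1 else 0) * activation q j e * capacity j e a z

/-- The queue state after a slot with action `a`, erasures `z` and arrivals `b`. At most one
packet leaves a buffer, and only if it is nonempty, so the subtraction does not truncate. -/
def nextState (q : QueueState) (a : SlotAction) (z : Feedback)
    (b : Fin 2 → Bool) : QueueState := fun j l =>
  q j l - (∑ e : Link, if e.src = l then moved q a z j e else 0)
    + (∑ e : Link, if e.dst = some l then moved q a z j e else 0)
    + (if l = .one ∧ b j = true then 1 else 0)

/-! ### The max-weight policy -/

section Policy

variable {Ω : Type*} [MeasurableSpace Ω]

/-- The feedback `(Z₁, …, Z_{t-1})` that is available at the beginning of slot `t`. -/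
def pastFeedback (Z : ℕ → Ω → Feedback) (t : ℕ) (ω : Ω) : Fin (t - 1) → Feedback :=
  fun i => Z (i + 1) ω

/-- The weight of action `a` in slot `t` given `Q_t = q` and `Z^{t-1} = z`:
`∑_j ∑_l ∑_m [q_l - q_m]⁺ E[C_{lm,t} | Q_t = q, Z^{t-1} = z]`, where the capacities `C_{lm,t}`
are those of action `a`. -/
noncomputable def actionWeight (μ : Measure Ω) (Z : ℕ → Ω → Feedback) (Q : ℕ → Ω → QueueState)
    (t : ℕ) (q : QueueState) (z : Fin (t - 1) → Feedback) (a : SlotAction) : ℝ :=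
  ∑ j : Fin 2, ∑ e : Link,
    max ((level q j (some e.src) : ℝ) - (level q j e.dst : ℝ)) 0 *
      ∫ ω, (capacity j e a (Z t ω) : ℝ)
        ∂(ProbabilityTheory.cond μ {ω | Q t ω = q ∧ pastFeedback Z t ω = z})

/-- The probability that the arrival indicator of a slot equals `b` if the rate is `r`. -/
def bernoulliMass (r : ℝ) (b : Bool) : ℝ := if b = true then r else 1 - r

/-- The network of queues over the channel `H` with hidden state, with arrival rates `R₁`, `R₂`,
operated by the max-weight policy. `St t` is the channel state (`t ≥ 0`); `Z t`, `B t`, `A t`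
are the erasures, the arrivals and the action in slot `t ≥ 1`; `Q t` is the queue state at the
beginning of slot `t ≥ 1`. -/
structure IsMaxWeightNetwork {S : Type*} [Fintype S] [DecidableEq S] (H : ErasureChannel S)
    (R₁ R₂ : ℝ) (μ : Measure Ω) (St : ℕ → Ω → S) (Z : ℕ → Ω → Feedback)
    (B : ℕ → Ω → Fin 2 → Bool) (A : ℕ → Ω → SlotAction) (Q : ℕ → Ω → QueueState) : Prop where
  measurable_state : ∀ t s, MeasurableSet {ω | St t ω = s}
  measurable_feedback : ∀ t z, MeasurableSet {ω | Z t ω = z}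
  measurable_arrival : ∀ t b, MeasurableSet {ω | B t ω = b}
  measurable_init : ∀ q, MeasurableSet {ω | Q 1 ω = q}
  /-- The joint law: the initial queue state, the channel and the two Bernoulli arrival
  processes are independent, and the channel starts in steady state. -/
  law : ∀ (n : ℕ) (q : QueueState) (s : ℕ → S) (z : ℕ → Feedback) (b : ℕ → Fin 2 → Bool),
    μ {ω | Q 1 ω = q ∧ St 0 ω = s 0 ∧
        ∀ t ∈ Finset.Icc 1 n, St t ω = s t ∧ Z t ω = z t ∧ B t ω = b t} =
      μ {ω | Q 1 ω = q} * ENNReal.ofReal (H.π (s 0) *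
        ∏ t ∈ Finset.Icc 1 n, H.P (s (t - 1)) (s t) * H.W (s t) (z t) *
          (bernoulliMass R₁ (b t 0) * bernoulliMass R₂ (b t 1)))
  /-- The initial backlog (for instance zero) has a finite second moment. -/
  init_sq : ∫⁻ ω, ∑ j : Fin 2, ∑ l : Buffer, (Q 1 ω j l : ENNReal) ^ 2 ∂μ < ⊤
  /-- The queue dynamics. -/
  queue_next : ∀ t ≥ 1, ∀ ω, Q (t + 1) ω = nextState (Q t ω) (A t ω) (Z t ω) (B t ω)
  /-- The action is a function of the current queue state and the whole past feedback. -/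
  action_causal : ∃ φ : ∀ t : ℕ, QueueState → (Fin (t - 1) → Feedback) → SlotAction,
    ∀ t ≥ 1, ∀ ω, A t ω = φ t (Q t ω) (pastFeedback Z t ω)
  /-- The action has maximal weight; ties are broken arbitrarily. -/
  action_max : ∀ t ≥ 1, ∀ ω, ∀ a : SlotAction,
    actionWeight μ Z Q t (Q t ω) (pastFeedback Z t ω) a ≤
      actionWeight μ Z Q t (Q t ω) (pastFeedback Z t ω) (A t ω)

/-- Strong stability of a queue with `X t` packets at time `t`:
`limsup_n (1/n) ∑_{t=1}^n E[X_t] < ∞`. -/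
def StronglyStable (μ : Measure Ω) (X : ℕ → Ω → ℕ) : Prop :=
  limsup (fun n : ℕ => (∑ t ∈ Finset.Icc 1 n, ∫⁻ ω, (X t ω : ENNReal) ∂μ) / (n : ENNReal))
    atTop < ⊤

end Policy

/-!
The quadratic Lyapunov function of the backlog has a negative drift under the max-weight policy,
because that policy compares favourably with a randomized policy which uses only a bounded window
of past feedback and whose average link capacities support the rates with a slack.

*The comparison policy.* A point of the outer region with a slack `δ` satisfies, for some `n`, the
constraints of the `n`-slot region with slack `δ / 2`, for certain functions `x₀`, `x₁` of the
feedback. Put `b = max (x₀ + x₁ - 1) 0` and `s = b - (x₀ + x₁ - 1)`. The policy sends an uncoded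
packet for receiver `j` with probability `x j - b`, a poisoned packet with probability `s`, and
divides `b` between coded and remedy packets in a constant ratio, which is chosen such that the
remedied flow balances the poisoned flow as well as possible (`exists_split`). Then two of the four
cuts between the first buffer and the exit have exactly the capacities in the two constraints on
the rate of a flow, and each of the other two is at least as large as one of them. A small
admixture of coded and remedy packets makes the outgoing capacity of the two other buffers
positive. By the layer-cake form of max-flow/min-cut (`weight_ge_of_cuts`), the max-weight value of
the average capacities exceeds the backlog-weighted rates by a multiple of the total backlog
(`ErasureChannel.exists_policy`).

*From averages to the random channel.* In a slot with at least `n` predecessors the comparison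
policy takes a uniformly distributed `k < n` and uses the last `k` feedback samples. The max-weight
action is at least as good on each event `{Q_t = q, Z^{t-1} = z}`, by its definition
(`IsMaxWeightNetwork.integral_slotWeight_ge`). The queues just before the window of `k + 1` slots
differ from `Q_t` by a bounded amount, and given the past the window has an expectation `h(S)` that
depends only on the last state `S` (`IsMaxWeightNetwork.integral_mul_window`). The `π`-average of
`h` is the required value. The fluctuation of `h` is not small, but since the chain is irreducible
it can be written as `g - P g` (Poisson equation, `ErasureChannel.exists_poisson`), and
the mean of the backlog times `g - P g` is, up to bounded terms, the decrement of the mean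
of the backlog times `g` (`IsMaxWeightNetwork.exists_window_average`). Hence it telescopes: it is
absorbed in a correction of the Lyapunov function that is linear in the backlog, and so is dominated
by the quadratic main term (`exists_sum_le_of_drift`).
-/

/-! ### Elementary facts on the channel -/

namespace ErasureChannel

variable {S : Type*} [Fintype S] [DecidableEq S] (H : ErasureChannel S)

lemma P_nonneg (s s' : S) : 0 ≤ H.P s s' :=
  Matrix.nonneg_of_mem_rowStochastic H.P_stochastic

lemma sum_P (s : S) : ∑ s', H.P s s' = 1 :=
  Matrix.sum_row_of_mem_rowStochastic H.P_stochastic s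

lemma W_nonneg (s : S) (w : Feedback) : 0 ≤ H.W s w := (H.W_mem s).1 w

lemma sum_W (s : S) : ∑ w, H.W s w = 1 := (H.W_mem s).2

lemma π_nonneg (s : S) : 0 ≤ H.π s := H.π_mem.1 s

lemma sum_π : ∑ s, H.π s = 1 := H.π_mem.2

/-! ### The Poisson equation of the state chain -/

/-- Maximum principle: the harmonic functions of an irreducible chain are constant. -/
lemma harmonic_const (v : S → ℝ) (hv : Matrix.mulVec H.P v = v) (i j : S) : v i = v j := by
  classical
  have hpow : ∀ k : ℕ, Matrix.mulVec (H.P ^ k) v = v := by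
    intro k
    induction k with
    | zero => simp
    | succ k ih => rw [pow_succ, ← Matrix.mulVec_mulVec, hv, ih]
  have : Nonempty S := ⟨i⟩
  obtain ⟨m, hm⟩ := Finite.exists_max v
  have key : ∀ j, v j = v m := by
    intro j
    obtain ⟨k, -, hk⟩ :=
      (Matrix.isIrreducible_iff_exists_pow_pos H.P_nonneg).1 H.P_irreducible m j
    have hst : H.P ^ k ∈ Matrix.rowStochastic ℝ S := pow_mem H.P_stochastic k
    have h0 : ∑ l, (H.P ^ k) m l * (v m - v l) = 0 := by
      have h1 : ∑ l, (H.P ^ k) m l * v l = v m := congrFun (hpow k) m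
      simp only [mul_sub, Finset.sum_sub_distrib, ← Finset.sum_mul, h1,
        Matrix.sum_row_of_mem_rowStochastic hst m]
      ring
    have h2 := (Finset.sum_eq_zero_iff_of_nonneg (fun l _ => mul_nonneg
      (Matrix.nonneg_of_mem_rowStochastic hst) (sub_nonneg.2 (hm l)))).1 h0 j (Finset.mem_univ j)
    rcases mul_eq_zero.1 h2 with h | h
    · exact absurd h hk.ne'
    · linarith
  rw [key i, key j]

/-- The Poisson equation of the state chain is solvable. The kernel of `P - 1` is the line of the
constants, so its range is a hyperplane, and this hyperplane is the kernel of the integration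
against `π`, which contains it. -/
lemma exists_poisson (f : S → ℝ) :
    ∃ g : S → ℝ, ∀ s, f s = (∑ i, H.π i * f i) + g s - ∑ s', H.P s s' * g s' := by
  classical
  set D : (S → ℝ) →ₗ[ℝ] (S → ℝ) := Matrix.toLin' H.P - 1 with hD
  set I : (S → ℝ) →ₗ[ℝ] ℝ := Fintype.linearCombination ℝ H.π with hI
  have hIv : ∀ v, I v = ∑ i, H.π i * v i := fun v => by
    simp [hI, Fintype.linearCombination_apply, mul_comm]
  have hDv : ∀ v s, D v s = (∑ s', H.P s s' * v s') - v s := fun v s => by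
    simp [hD, Matrix.mulVec, dotProduct]
  have hne : Nonempty S := by
    by_contra h
    rw [not_nonempty_iff] at h
    simpa using H.sum_π
  have hker : Module.finrank ℝ (LinearMap.ker D) ≤ 1 := by
    refine finrank_le_one ⟨1, ?_⟩ ?_
    · rw [LinearMap.mem_ker]
      ext s
      simp [hDv, H.sum_P]
    · rintro ⟨v, hv⟩
      have hv' : Matrix.mulVec H.P v = v := by
        simpa [hD, sub_eq_zero] using hv
      refine ⟨v hne.some, Subtype.ext ?_⟩
      ext s
      simp [H.harmonic_const v hv' hne.some s]
  have hle : LinearMap.range D ≤ LinearMap.ker I := by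
    rintro _ ⟨v, rfl⟩
    rw [LinearMap.mem_ker, hIv]
    have h1 : ∑ i, H.π i * ∑ s', H.P i s' * v s' = ∑ i, H.π i * v i := by
      have : ∀ s', ∑ i, H.π i * H.P i s' = H.π s' := fun s' => congrFun H.π_stationary s'
      simp only [Finset.mul_sum]
      rw [Finset.sum_comm]
      refine Finset.sum_congr rfl fun s' _ => ?_
      rw [← this s', Finset.sum_mul]
      exact Finset.sum_congr rfl fun i _ => by ring
    simp only [hDv, mul_sub, Finset.sum_sub_distrib, h1, sub_self]
  have hI1 : I 1 = 1 := by simp [hIv, H.sum_π]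
  have hsurj : LinearMap.range I = ⊤ := by
    rw [LinearMap.range_eq_top]
    intro c
    exact ⟨c • (1 : S → ℝ), by rw [map_smul, hI1]; simp⟩
  have e1 := LinearMap.finrank_range_add_finrank_ker D
  have e2 := LinearMap.finrank_range_add_finrank_ker I
  rw [hsurj, finrank_top, Module.finrank_self] at e2
  have heq : LinearMap.range D = LinearMap.ker I :=
    Submodule.eq_of_le_of_finrank_le hle (by omega)
  have hmem : (I f) • (1 : S → ℝ) - f ∈ LinearMap.ker I := by
    rw [LinearMap.mem_ker, map_sub, map_smul, hI1]
    simp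
  rw [← heq] at hmem
  obtain ⟨g, hg⟩ := hmem
  refine ⟨g, fun s => ?_⟩
  have := congrFun hg s
  rw [hDv] at this
  simp only [Pi.sub_apply, Pi.smul_apply, Pi.one_apply, smul_eq_mul, mul_one] at this
  rw [← hIv]
  linarith

/-! ### The law of the feedback -/

lemma _root_.Fintype.sum_fin_cons {α M : Type*} [Fintype α] [AddCommMonoid M] (k : ℕ)
    (f : (Fin (k + 1) → α) → M) : ∑ z, f z = ∑ a, ∑ z : Fin k → α, f (Fin.cons a z) :=
  ((Fin.consEquiv fun _ : Fin (k + 1) => α).sum_comp f).symm.trans (Fintype.sum_prod_type _)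

lemma _root_.Fintype.sum_fin_snoc {α M : Type*} [Fintype α] [AddCommMonoid M] (k : ℕ)
    (f : (Fin (k + 1) → α) → M) : ∑ z, f z = ∑ z : Fin k → α, ∑ a, f (Fin.snoc z a) :=
  ((Fin.snocEquiv fun _ : Fin (k + 1) => α).sum_comp f).symm.trans
    (Fintype.sum_prod_type_right _)

/-- The probability of the feedback samples `z` if the initial state has the weights `ν`. -/
noncomputable def pathProb (ν : S → ℝ) (k : ℕ) (z : Fin k → Feedback) : ℝ :=
  ∑ s : Fin (k + 1) → S,
    ν (s 0) * ∏ i : Fin k, H.P (s i.castSucc) (s i.succ) * H.W (s i.succ) (z i)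

/-- The expectation of `r (Z₁, …, Z_k)` if the state chain starts in `s`. -/
noncomputable def obsExp : (k : ℕ) → ((Fin k → Feedback) → ℝ) → S → ℝ
  | 0, r, _ => r Fin.elim0
  | k + 1, r, s =>
    ∑ s', H.P s s' * ∑ w, H.W s' w * obsExp k (fun z => r (Fin.cons w z)) s'

lemma pathProb_cons (ν : S → ℝ) (k : ℕ) (w : Feedback) (z : Fin k → Feedback) :
    H.pathProb ν (k + 1) (Fin.cons w z) =
      H.pathProb (fun t => ∑ s, ν s * (H.P s t * H.W t w)) k z := by
  unfold pathProb
  rw [Fintype.sum_fin_cons, Finset.sum_comm]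
  refine Finset.sum_congr rfl fun s _ => ?_
  rw [Finset.sum_mul]
  refine Finset.sum_congr rfl fun s0 _ => ?_
  rw [Fin.prod_univ_succ]
  simp only [Fin.cons_zero, Fin.cons_succ, Fin.castSucc_zero,
    ← Fin.succ_castSucc]
  ring

/-- The recursion along the chain and the sum over all state paths give the same expectation. -/
lemma sum_mul_obsExp (ν : S → ℝ) (k : ℕ) (r : (Fin k → Feedback) → ℝ) :
    ∑ s, ν s * H.obsExp k r s = ∑ z, H.pathProb ν k z * r z := by
  induction k generalizing ν with
  | zero =>
    simp only [obsExp, pathProb, Finset.sum_mul]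
    rw [Fintype.sum_unique (ι := Fin 0 → Feedback), Fintype.sum_fin_cons]
    simp [Subsingleton.elim default Fin.elim0]
  | succ k ih =>
    rw [Fintype.sum_fin_cons (α := Feedback) k]
    simp only [pathProb_cons, obsExp, ← ih, Finset.mul_sum, Finset.sum_mul]
    rw [Finset.sum_comm, Finset.sum_comm (s := (Finset.univ : Finset Feedback))]
    refine Finset.sum_congr rfl fun s' _ => ?_
    rw [Finset.sum_comm]
    exact Finset.sum_congr rfl fun w _ => Finset.sum_congr rfl fun s _ => by ring

lemma sum_π_mul_obsExp (k : ℕ) (r : (Fin k → Feedback) → ℝ) :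
    ∑ s, H.π s * H.obsExp k r s = ∑ z, H.feedbackProb k z * r z :=
  H.sum_mul_obsExp H.π k r

lemma feedbackProb_nonneg (k : ℕ) (z : Fin k → Feedback) : 0 ≤ H.feedbackProb k z :=
  Finset.sum_nonneg fun _ _ => mul_nonneg (H.π_nonneg _)
    (Finset.prod_nonneg fun _ _ => mul_nonneg (H.P_nonneg _ _) (H.W_nonneg _ _))

lemma sum_feedbackProb_snoc (k : ℕ) (z : Fin k → Feedback) :
    ∑ w, H.feedbackProb (k + 1) (Fin.snoc z w) = H.feedbackProb k z := by
  unfold feedbackProb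
  rw [Finset.sum_comm, Fintype.sum_fin_snoc]
  refine Finset.sum_congr rfl fun s _ => ?_
  have h0 : ∀ x : S, (Fin.snoc s x : Fin (k + 2) → S) 0 = s 0 := fun x => by
    rw [← Fin.castSucc_zero, Fin.snoc_castSucc]
  simp only [Fin.prod_univ_castSucc, Fin.snoc_castSucc, Fin.snoc_last,
    Fin.succ_last, Fin.succ_castSucc, h0]
  simp only [← Finset.mul_sum, H.sum_W, mul_one, H.sum_P]

lemma sum_feedbackProb (k : ℕ) : ∑ z, H.feedbackProb k z = 1 := by
  induction k with
  | zero =>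
    have := H.sum_π_mul_obsExp 0 (fun _ => 1)
    simpa [obsExp, H.sum_π] using this.symm
  | succ k ih =>
    rw [Fintype.sum_fin_snoc (α := Feedback) k]
    simp only [H.sum_feedbackProb_snoc, ih]

/-- Where `P(z) = 0` the quotient `predict z w` is the junk value `0`, and so is
`P(z, w) ≤ P(z)`. -/
lemma feedbackProb_mul_predict (k : ℕ) (z : Fin k → Feedback) (w : Feedback) :
    H.feedbackProb k z * H.predict z w = H.feedbackProb (k + 1) (Fin.snoc z w) := by
  unfold predict
  by_cases h : H.feedbackProb k z = 0
  · have h1 := H.sum_feedbackProb_snoc k z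
    rw [h] at h1
    have := (Finset.sum_eq_zero_iff_of_nonneg
      (fun w _ => H.feedbackProb_nonneg (k + 1) (Fin.snoc z w))).1 h1 w (Finset.mem_univ w)
    rw [this, h, zero_mul]
  · field_simp

end ErasureChannel

/-! ### Drift of the queues in one slot -/

lemma Buffer.sum_univ {M : Type*} [AddCommMonoid M] (f : Buffer → M) :
    ∑ l, f l = f .one + f .two + f .three := by
  change ∑ l ∈ {Buffer.one, .two, .three}, f l = _
  simp [add_assoc]

lemma Link.sum_univ {M : Type*} [AddCommMonoid M] (f : Link → M) :
    ∑ e, f e = f .l12 + f .l13 + f .l14 + f .l24 + f .l32 + f .l34 := by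
  change ∑ e ∈ {Link.l12, .l13, .l14, .l24, .l32, .l34}, f e = _
  simp [add_assoc]

/-- The positive part of the differential backlog of a link. -/
noncomputable def diffBacklog (q : QueueState) (j : Fin 2) (e : Link) : ℝ :=
  max ((level q j (some e.src) : ℝ) - (level q j e.dst : ℝ)) 0

/-- The weight of an action, with the erasures `z` of the slot known. -/
noncomputable def slotWeight (q : QueueState) (a : SlotAction) (z : Feedback) : ℝ :=
  ∑ j : Fin 2, ∑ e : Link, diffBacklog q j e * (capacity j e a z : ℝ)

/-- The quadratic Lyapunov function. -/
def sqBacklog (q : QueueState) : ℝ := ∑ j : Fin 2, ∑ l : Buffer, (q j l : ℝ) ^ 2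

/-- The total number of packets in the network. -/
def totalBacklog (q : QueueState) : ℝ := ∑ j : Fin 2, ∑ l : Buffer, (q j l : ℝ)

lemma capacity_le_one (j : Fin 2) (e : Link) (a : SlotAction) (z : Feedback) :
    capacity j e a z ≤ 1 := by
  unfold capacity
  split <;> (try split_ifs) <;> simp

lemma moved_le_capacity (q : QueueState) (a : SlotAction) (z : Feedback) (j : Fin 2) (e : Link) :
    moved q a z j e ≤ capacity j e a z := by
  unfold moved activation
  split_ifs <;> simp

lemma moved_eq_zero (q : QueueState) (a : SlotAction) (z : Feedback) (j : Fin 2) (e : Link)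
    (h : q j e.src = 0) : moved q a z j e = 0 := by
  simp [moved, h]

/-- A link with a positive differential backlog is active and its source is not empty, so that it
moves as many packets as its capacity allows. -/
lemma diffBacklog_mul_capacity (q : QueueState) (a : SlotAction) (z : Feedback) (j : Fin 2)
    (e : Link) : diffBacklog q j e * (capacity j e a z : ℝ) =
      ((q j e.src : ℝ) - (level q j e.dst : ℝ)) * (moved q a z j e : ℝ) := by
  have h0 : level q j (some e.src) = q j e.src := rfl
  unfold diffBacklog moved activation
  rw [h0]
  by_cases h : level q j e.dst < q j e.src
  · have h1 : (level q j e.dst : ℝ) < q j e.src := by exact_mod_cast h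
    rw [max_eq_left (by linarith), if_pos h, if_pos (by omega)]
    simp
  · have h1 : (q j e.src : ℝ) ≤ level q j e.dst := by exact_mod_cast not_lt.1 h
    rw [max_eq_right (by linarith), if_neg h]
    simp

/-- The number of packets that leave a buffer. -/
def outFlow (q : QueueState) (a : SlotAction) (z : Feedback) (j : Fin 2) (l : Buffer) : ℕ :=
  ∑ e : Link, if e.src = l then moved q a z j e else 0

/-- The number of packets that enter a buffer from other buffers. -/
def inFlow (q : QueueState) (a : SlotAction) (z : Feedback) (j : Fin 2) (l : Buffer) : ℕ :=
  ∑ e : Link, if e.dst = some l then moved q a z j e else 0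

lemma outFlow_le_one (q : QueueState) (a : SlotAction) (z : Feedback) (j : Fin 2) (l : Buffer) :
    outFlow q a z j l ≤ 1 := by
  have h : outFlow q a z j l ≤ ∑ e : Link, if e.src = l then capacity j e a z else 0 :=
    Finset.sum_le_sum fun e _ => by split_ifs <;> simp [moved_le_capacity]
  refine h.trans ?_
  rw [Link.sum_univ]
  cases l <;> cases a <;> simp [Link.src, capacity] <;> split_ifs <;> simp_all

lemma outFlow_le (q : QueueState) (a : SlotAction) (z : Feedback) (j : Fin 2) (l : Buffer) :
    outFlow q a z j l ≤ q j l := by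
  rcases Nat.eq_zero_or_pos (q j l) with h | h
  · refine (Finset.sum_eq_zero fun e _ => ?_).le.trans (Nat.zero_le _)
    split_ifs with he
    · exact moved_eq_zero q a z j e (he ▸ h)
    · rfl
  · exact (outFlow_le_one q a z j l).trans h

lemma inFlow_le_one (q : QueueState) (a : SlotAction) (z : Feedback) (j : Fin 2) (l : Buffer) :
    inFlow q a z j l ≤ 1 := by
  have h : inFlow q a z j l ≤ ∑ e : Link, if e.dst = some l then capacity j e a z else 0 :=
    Finset.sum_le_sum fun e _ => by split_ifs <;> simp [moved_le_capacity]
  refine h.trans ?_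
  rw [Link.sum_univ]
  cases l <;> cases a <;> simp [Link.dst, capacity] <;> split_ifs <;> simp_all

lemma nextState_cast (q : QueueState) (a : SlotAction) (z : Feedback) (b : Fin 2 → Bool)
    (j : Fin 2) (l : Buffer) :
    (nextState q a z b j l : ℝ) = q j l - outFlow q a z j l + inFlow q a z j l +
      if l = .one ∧ b j = true then 1 else 0 := by
  have h : nextState q a z b j l = q j l - outFlow q a z j l + inFlow q a z j l +
      if l = .one ∧ b j = true then 1 else 0 := rfl
  rw [h]
  push_cast [outFlow_le q a z j l]
  rfl

lemma abs_nextState_sub_le (q : QueueState) (a : SlotAction) (z : Feedback) (b : Fin 2 → Bool)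
    (j : Fin 2) (l : Buffer) : |(nextState q a z b j l : ℝ) - q j l| ≤ 2 := by
  have h1 : (outFlow q a z j l : ℝ) ≤ 1 := by exact_mod_cast outFlow_le_one q a z j l
  have h2 : (inFlow q a z j l : ℝ) ≤ 1 := by exact_mod_cast inFlow_le_one q a z j l
  have h3 : (0 : ℝ) ≤ outFlow q a z j l := Nat.cast_nonneg _
  have h4 : (0 : ℝ) ≤ inFlow q a z j l := Nat.cast_nonneg _
  rw [nextState_cast, abs_le]
  split_ifs <;> constructor <;> linarith

/-- Summation by parts: the net outflow of the buffers, weighted with the queue lengths, is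
the weight of the action. -/
lemma sum_mul_netFlow (q : QueueState) (a : SlotAction) (z : Feedback) :
    ∑ j, ∑ l, (q j l : ℝ) * ((outFlow q a z j l : ℝ) - inFlow q a z j l) = slotWeight q a z := by
  unfold slotWeight
  refine Finset.sum_congr rfl fun j _ => ?_
  simp only [diffBacklog_mul_capacity, outFlow, inFlow, Link.sum_univ, Buffer.sum_univ, Link.src,
    Link.dst, level]
  simp
  ring

lemma sqBacklog_nextState_le (q : QueueState) (a : SlotAction) (z : Feedback)
    (b : Fin 2 → Bool) :
    sqBacklog (nextState q a z b) ≤ sqBacklog q + 24 +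
      2 * ∑ j, (q j .one : ℝ) * (if b j = true then 1 else 0) - 2 * slotWeight q a z := by
  have key : ∀ j l, (nextState q a z b j l : ℝ) ^ 2 ≤ (q j l : ℝ) ^ 2 + 4 +
      2 * ((q j l : ℝ) * (if l = .one ∧ b j = true then 1 else 0)) -
      2 * ((q j l : ℝ) * ((outFlow q a z j l : ℝ) - inFlow q a z j l)) := by
    intro j l
    have h := abs_le.1 (abs_nextState_sub_le q a z b j l)
    have h' := sq_le_sq' h.1 h.2
    have h2 := nextState_cast q a z b j l
    generalize (if l = .one ∧ b j = true then (1 : ℝ) else 0) = β at h2 ⊢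
    have h3 : (nextState q a z b j l : ℝ) - q j l =
      β - ((outFlow q a z j l : ℝ) - inFlow q a z j l) := by linarith
    nlinarith
  have h := Finset.sum_le_sum fun j (_ : j ∈ Finset.univ) =>
    Finset.sum_le_sum fun l (_ : l ∈ Finset.univ) => key j l
  simp only [Finset.sum_add_distrib, Finset.sum_sub_distrib, ← Finset.mul_sum] at h
  rw [sum_mul_netFlow] at h
  refine h.trans (le_of_eq ?_)
  have e1 : ∑ j : Fin 2, ∑ l : Buffer,
      (q j l : ℝ) * (if l = .one ∧ b j = true then (1 : ℝ) else 0) =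
      ∑ j, (q j .one : ℝ) * (if b j = true then 1 else 0) :=
    Finset.sum_congr rfl fun j _ => by simp [Buffer.sum_univ]
  have e2 : ∑ _j : Fin 2, ∑ _l : Buffer, (4 : ℝ) = 24 := by
    simp only [Buffer.sum_univ]
    norm_num
  rw [e1, e2]
  rfl

lemma abs_diffBacklog_sub_le (q q' : QueueState) (c : ℝ)
    (h : ∀ j l, |(q j l : ℝ) - q' j l| ≤ c) (j : Fin 2) (e : Link) :
    |diffBacklog q j e - diffBacklog q' j e| ≤ 2 * c := by
  have hl : ∀ o : Option Buffer, |(level q j o : ℝ) - level q' j o| ≤ c := by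
    intro o
    cases o with
    | none => simpa [level] using (abs_nonneg _).trans (h 0 .one)
    | some l => exact h j l
  have h1 := hl (some e.src)
  have h2 := hl e.dst
  refine (abs_max_sub_max_le_abs _ _ 0).trans ?_
  rw [abs_le] at *
  constructor <;> linarith

lemma diffBacklog_nonneg (q : QueueState) (j : Fin 2) (e : Link) : 0 ≤ diffBacklog q j e :=
  le_max_right _ _

lemma diffBacklog_le (q : QueueState) (j : Fin 2) (e : Link) : diffBacklog q j e ≤ q j e.src :=
  max_le (by have : (0 : ℝ) ≤ level q j e.dst := Nat.cast_nonneg _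
             change (q j e.src : ℝ) - _ ≤ _; linarith) (Nat.cast_nonneg _)

/-! ### Cuts -/

/-- If every cut between the first buffer and the exit has at least the capacity `r + ε`, and
every other nonempty set of buffers has an outgoing capacity of at least `ε`, then the total
weight of the links with capacities `c` exceeds `r` times the first backlog by a multiple of the
total backlog: the weight is the integral over `u` of the outgoing capacities of the sets of
the buffers with more than `u` packets. -/
lemma weight_ge_of_cuts (c : Link → ℝ) (r ε : ℝ) (hε : 0 ≤ ε)
    (h1 : r + ε ≤ c .l12 + c .l13 + c .l14)
    (h12 : r + ε ≤ c .l13 + c .l14 + c .l24)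
    (h13 : r + ε ≤ c .l12 + c .l14 + c .l32 + c .l34)
    (h123 : r + ε ≤ c .l14 + c .l24 + c .l34)
    (h2 : ε ≤ c .l24) (h3 : ε ≤ c .l32 + c .l34) (h23 : ε ≤ c .l24 + c .l34)
    (q : QueueState) (j : Fin 2) :
    r * q j .one + ε / 3 * ∑ l, (q j l : ℝ) ≤ ∑ e, diffBacklog q j e * c e := by
  rw [Link.sum_univ, Buffer.sum_univ]
  simp only [diffBacklog, Link.src, Link.dst, level, Option.elim]
  have p1 : (0 : ℝ) ≤ q j .one := Nat.cast_nonneg _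
  have p2 : (0 : ℝ) ≤ q j .two := Nat.cast_nonneg _
  have p3 : (0 : ℝ) ≤ q j .three := Nat.cast_nonneg _
  generalize (q j .one : ℝ) = x at *
  generalize (q j .two : ℝ) = y at *
  generalize (q j .three : ℝ) = z at *
  have hx := mul_nonneg hε p1
  have hy := mul_nonneg hε p2
  have hz := mul_nonneg hε p3
  -- one layer of the backlog vector contributes its height times the capacity of its cut
  have lay : ∀ {w w' a b : ℝ}, w' ≤ w → a ≤ b → (w - w') * a ≤ (w - w') * b :=
    fun hw hab => mul_le_mul_of_nonneg_left hab (sub_nonneg.2 hw)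
  simp only [Nat.cast_zero, sub_zero, max_eq_left p1, max_eq_left p2, max_eq_left p3]
  rcases le_total x y with a | a <;> rcases le_total y z with b | b <;>
    rcases le_total x z with d | d
  · rw [max_eq_right (by linarith : x - y ≤ 0), max_eq_right (by linarith : x - z ≤ 0),
      max_eq_left (by linarith : 0 ≤ z - y)]
    have l1 := lay b h3
    have l2 := lay a h23
    have l3 := lay p1 h123
    have := mul_le_mul_of_nonneg_left b hε
    have := mul_le_mul_of_nonneg_left a hε
    linarith
  · have e1 : y = x := by linarith
    have e2 : z = x := by linarith
    subst e1 e2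
    simp
    have l3 := lay p1 h123
    linarith
  · rw [max_eq_right (by linarith : x - y ≤ 0), max_eq_right (by linarith : x - z ≤ 0),
      max_eq_right (by linarith : z - y ≤ 0)]
    have l1 := lay b h2
    have l2 := lay d h23
    have l3 := lay p1 h123
    have := mul_le_mul_of_nonneg_left b hε
    have := mul_le_mul_of_nonneg_left a hε
    linarith
  · rw [max_eq_right (by linarith : x - y ≤ 0), max_eq_left (by linarith : 0 ≤ x - z),
      max_eq_right (by linarith : z - y ≤ 0)]
    have l1 := lay a h2
    have l2 := lay d h12
    have l3 := lay p3 h123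
    have := mul_le_mul_of_nonneg_left b hε
    have := mul_le_mul_of_nonneg_left a hε
    linarith
  · rw [max_eq_left (by linarith : 0 ≤ x - y), max_eq_right (by linarith : x - z ≤ 0),
      max_eq_left (by linarith : 0 ≤ z - y)]
    have l1 := lay d h3
    have l2 := lay a h13
    have l3 := lay p2 h123
    have := mul_le_mul_of_nonneg_left b hε
    have := mul_le_mul_of_nonneg_left d hε
    linarith
  · rw [max_eq_left (by linarith : 0 ≤ x - y), max_eq_left (by linarith : 0 ≤ x - z),
      max_eq_left (by linarith : 0 ≤ z - y)]
    have l1 := lay d h1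
    have l2 := lay b h13
    have l3 := lay p2 h123
    have := mul_le_mul_of_nonneg_left a hε
    have := mul_le_mul_of_nonneg_left d hε
    linarith
  · have e1 : y = x := by linarith
    have e2 : z = x := by linarith
    subst e1 e2
    simp
    have l3 := lay p1 h123
    linarith
  · rw [max_eq_left (by linarith : 0 ≤ x - y), max_eq_left (by linarith : 0 ≤ x - z),
      max_eq_right (by linarith : z - y ≤ 0)]
    have l1 := lay a h1
    have l2 := lay b h12
    have l3 := lay p3 h123
    have := mul_le_mul_of_nonneg_left a hε
    have := mul_le_mul_of_nonneg_left d hε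
    linarith

/-! ### The stationary policy of a rate pair in the region -/

/-- There are five actions. -/
instance : Fintype SlotAction where
  elems := ⟨{.uncoded 0, .uncoded 1, .coded, .poison, .remedy}, by simp⟩
  complete a := by
    rw [Finset.mem_mk]
    rcases a with j | _ | _ | _
    · fin_cases j <;> simp
    all_goals simp

lemma SlotAction.sum_univ {M : Type*} [AddCommMonoid M] (f : SlotAction → M) :
    ∑ a, f a = f (.uncoded 0) + f (.uncoded 1) + f .coded + f .poison + f .remedy := by
  change Multiset.sum (Multiset.map f {.uncoded 0, .uncoded 1, .coded, .poison, .remedy}) = _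
  simp [add_assoc]

lemma Feedback.sum_univ {M : Type*} [AddCommMonoid M] (f : Feedback → M) :
    ∑ w, f w = f ![true, true] + f ![true, false] + f ![false, true] + f ![false, false] := by
  rw [← (finTwoArrowEquiv Bool).symm.sum_comp, Fintype.sum_prod_type]
  simp [finTwoArrowEquiv, add_assoc]

/-- The indicator of the slots in which receiver `j` gets the packet. -/
def received (j : Fin 2) (w : Feedback) : ℝ := if w j = false then 1 else 0

/-- The indicator of the slots in which some receiver gets the packet. -/
def receivedSome (w : Feedback) : ℝ := if w 0 = true ∧ w 1 = true then 0 else 1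

lemma received_nonneg (j : Fin 2) (w : Feedback) : 0 ≤ received j w := by
  unfold received; split_ifs <;> norm_num

lemma received_le (j : Fin 2) (w : Feedback) : received j w ≤ receivedSome w := by
  unfold received receivedSome
  fin_cases j <;> simp <;> split_ifs <;> simp_all

lemma received_le_one (j : Fin 2) (w : Feedback) : received j w ≤ 1 := by
  unfold received; split_ifs <;> norm_num

lemma receivedSome_sub (j : Fin 2) (w : Feedback) :
    (if w j = true ∧ w j.rev = false then (1 : ℝ) else 0) = receivedSome w - received j w := by
  unfold received receivedSome
  have h0 : (0 : Fin 2).rev = 1 := rfl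
  have h1 : (1 : Fin 2).rev = 0 := rfl
  rcases h : w 0 <;> rcases h' : w 1 <;> fin_cases j <;> simp [h0, h1, h, h']

/-- The mean capacity of the links of flow `j` if action `a` is chosen with probability `p a`
and the erasures are `w`. -/
def meanCapacity (p : SlotAction → ℝ) (j : Fin 2) (e : Link) (w : Feedback) : ℝ :=
  ∑ a, p a * (capacity j e a w : ℝ)

lemma meanCapacity_eq (p : SlotAction → ℝ) (j : Fin 2) (e : Link) (w : Feedback) :
    meanCapacity p j e w = match e with
      | .l12 => p (.uncoded j) * (receivedSome w - received j w)
      | .l13 => p .poison * receivedSome w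
      | .l14 => p (.uncoded j) * received j w
      | .l24 => p .coded * received j w
      | .l32 => p .remedy * (receivedSome w - received j w)
      | .l34 => p .remedy * received j w := by
  rw [← receivedSome_sub]
  unfold meanCapacity received receivedSome
  rw [SlotAction.sum_univ]
  cases e <;> fin_cases j <;> simp [capacity]

lemma meanCapacity_nonneg {p : SlotAction → ℝ} (hp : ∀ a, 0 ≤ p a) (j : Fin 2) (e : Link)
    (w : Feedback) : 0 ≤ meanCapacity p j e w :=
  Finset.sum_nonneg fun a _ => mul_nonneg (hp a) (Nat.cast_nonneg _)

lemma meanCapacity_le_one {p : SlotAction → ℝ} (hp : ∀ a, 0 ≤ p a) (hp1 : ∑ a, p a = 1)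
    (j : Fin 2) (e : Link) (w : Feedback) : meanCapacity p j e w ≤ 1 := by
  rw [← hp1]
  exact Finset.sum_le_sum fun a _ => mul_le_of_le_one_right (hp a)
    (by exact_mod_cast capacity_le_one j e a w)

namespace ErasureChannel

variable {S : Type*} [Fintype S] [DecidableEq S] (H : ErasureChannel S)

/-- The average over the first `n` slots of the expectation of `f k (Z₁, …, Z_k) Z_{k+1}`, where
slot `k + 1` has `k` past feedback samples, as a linear functional of `f`. -/
noncomputable def slotExp (n : ℕ) :
    ((k : ℕ) → (Fin k → Feedback) → Feedback → ℝ) →ₗ[ℝ] ℝ where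
  toFun f := (1 / (n : ℝ)) * ∑ k ∈ Finset.range n, ∑ z : Fin k → Feedback, ∑ w,
    H.feedbackProb (k + 1) (Fin.snoc z w) * f k z w
  map_add' f g := by simp only [Pi.add_apply, mul_add, Finset.sum_add_distrib]
  map_smul' c f := by
    simp only [Pi.smul_apply, smul_eq_mul, RingHom.id_apply, Finset.mul_sum]
    exact Finset.sum_congr rfl fun k _ => Finset.sum_congr rfl fun z _ =>
      Finset.sum_congr rfl fun w _ => by ring

lemma slotExp_apply (n : ℕ) (f : (k : ℕ) → (Fin k → Feedback) → Feedback → ℝ) :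
    H.slotExp n f = (1 / (n : ℝ)) * ∑ k ∈ Finset.range n, ∑ z : Fin k → Feedback, ∑ w,
      H.feedbackProb (k + 1) (Fin.snoc z w) * f k z w := rfl

lemma slotExp_mono (n : ℕ) {f g : (k : ℕ) → (Fin k → Feedback) → Feedback → ℝ}
    (h : ∀ k z w, f k z w ≤ g k z w) : H.slotExp n f ≤ H.slotExp n g := by
  rw [slotExp_apply, slotExp_apply]
  refine mul_le_mul_of_nonneg_left ?_ (by positivity)
  exact Finset.sum_le_sum fun k _ => Finset.sum_le_sum fun z _ => Finset.sum_le_sum fun w _ =>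
    mul_le_mul_of_nonneg_left (h k z w) (H.feedbackProb_nonneg _ _)

lemma slotExp_nonneg (n : ℕ) {f : (k : ℕ) → (Fin k → Feedback) → Feedback → ℝ}
    (h : ∀ k z w, 0 ≤ f k z w) : 0 ≤ H.slotExp n f := by
  simpa using H.slotExp_mono n (f := 0) h

lemma slotExp_one_le (n : ℕ) : H.slotExp n (fun _ _ _ => 1) ≤ 1 := by
  rw [slotExp_apply]
  simp only [mul_one, H.sum_feedbackProb_snoc, H.sum_feedbackProb, Finset.sum_const,
    Finset.card_range, nsmul_eq_mul, one_div]
  exact inv_mul_le_one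

lemma sum_snoc_mul_received (j : Fin 2) (k : ℕ) (z : Fin k → Feedback) :
    ∑ w, H.feedbackProb (k + 1) (Fin.snoc z w) * received j w =
      H.feedbackProb k z * (1 - ![H.eps1 z, H.eps2 z] j) := by
  have h := H.sum_feedbackProb_snoc k z
  rw [Feedback.sum_univ] at h ⊢
  fin_cases j <;> simp [received, eps1, eps2, eps12, mul_add, mul_sub, H.feedbackProb_mul_predict]
    <;> linarith

lemma sum_snoc_mul_receivedSome (k : ℕ) (z : Fin k → Feedback) :
    ∑ w, H.feedbackProb (k + 1) (Fin.snoc z w) * receivedSome w =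
      H.feedbackProb k z * (1 - H.eps12 z) := by
  have h := H.sum_feedbackProb_snoc k z
  rw [Feedback.sum_univ] at h ⊢
  simp [receivedSome, eps12, mul_sub, H.feedbackProb_mul_predict]
  linarith

lemma slotAverage_received (n : ℕ) (j : Fin 2) (x : ∀ k : ℕ, (Fin k → Feedback) → ℝ) :
    H.slotAverage n (fun k z => (1 - ![H.eps1 z, H.eps2 z] j) * x k z) =
      H.slotExp n (fun k z w => received j w * x k z) := by
  rw [slotExp_apply]
  simp only [slotAverage, ← mul_assoc, ← Finset.sum_mul, sum_snoc_mul_received]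

lemma slotAverage_receivedSome (n : ℕ) (x : ∀ k : ℕ, (Fin k → Feedback) → ℝ) :
    H.slotAverage n (fun k z => (1 - H.eps12 z) * x k z) =
      H.slotExp n (fun k z w => receivedSome w * x k z) := by
  rw [slotExp_apply]
  simp only [slotAverage, ← mul_assoc, ← Finset.sum_mul, sum_snoc_mul_receivedSome]

/-- A rate pair in the interior of the outer region satisfies the constraints of some `n`-slot
region with a slack. -/
lemma exists_slots_of_mem_outerRegion (R : Fin 2 → ℝ) (δ : ℝ) (hδ : 0 < δ)
    (hR : (R 0 + δ, R 1 + δ) ∈ H.outerRegion) :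
    ∃ n : ℕ, ∃ x : Fin 2 → ∀ k : ℕ, (Fin k → Feedback) → ℝ,
      (∀ j k z, x j k z ∈ Set.Icc (0 : ℝ) 1) ∧
      (∀ j, R j + δ / 2 ≤ H.slotExp n (fun k z w => received j w * x j k z)) ∧
      (∀ j, R j + δ / 2 ≤ H.slotExp n (fun k z w => receivedSome w * (1 - x j.rev k z))) := by
  rw [outerRegion, Filter.mem_limsup_iff_frequently_mem] at hR
  obtain ⟨n, hn⟩ := hR.exists
  obtain ⟨⟨r1, r2⟩, ⟨-, -, x, y, hx, hy, h1, h2, h3, h4⟩, hd⟩ :=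
    Metric.mem_closure_iff.1 hn (δ / 2) (by positivity)
  rw [Prod.dist_eq, max_lt_iff, Real.dist_eq, Real.dist_eq, abs_lt, abs_lt] at hd
  simp only at hd h1 h2 h3 h4
  refine ⟨n, ![x, y], fun j => by fin_cases j <;> assumption, fun j => ?_, fun j => ?_⟩
  · rw [← slotAverage_received]
    fin_cases j
    · exact le_trans (by simp; linarith) h1
    · exact le_trans (by simp; linarith) h3
  · rw [← H.slotAverage_receivedSome n (fun k z => 1 - ![x, y] j.rev k z)]
    fin_cases j
    · exact le_trans (by simp; linarith) h2
    · exact le_trans (by simp; linarith) h4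

/-- The share `l` of the remedy packets among the coded and remedy packets. With `M` the mean flow
of poisoned packets and `E` the mean flow that could be remedied, either the remedied flow `l * E`
balances `M`, or all of `E` is remedied and still does not exceed `M`. -/
lemma exists_split {E M : ℝ} (hE : 0 ≤ E) (hM : 0 ≤ M) :
    ∃ l : ℝ, 0 ≤ l ∧ l ≤ 1 ∧ l * E ≤ M ∧ (l * E = M ∨ l = 1) := by
  by_cases h : M < E
  · have hE' : 0 < E := hM.trans_lt h
    have : M / E * E = M := div_mul_cancel₀ M hE'.ne'
    exact ⟨M / E, div_nonneg hM hE, (div_le_one hE').2 h.le, this.le, Or.inl this⟩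
  · exact ⟨1, zero_le_one, le_rfl, by linarith, Or.inr rfl⟩

/-- The randomized action that sends uncoded packets for receiver `j` with the probability
`x j - b`, poisoned packets with the probability `s`, and that divides the probability `b` among
coded and remedy packets in the ratio `1 - l : l`; with probability `κ` it is replaced by
a fair choice between coded and remedy packets. -/
noncomputable def mixedAction (κ l : ℝ) (x : Fin 2 → ℝ) (b s : ℝ) : SlotAction → ℝ
  | .uncoded j => (1 - κ) * (x j - b)
  | .coded => (1 - κ) * ((1 - l) * b) + κ / 2
  | .poison => (1 - κ) * s
  | .remedy => (1 - κ) * (l * b) + κ / 2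

/-- The cut conditions of flow `j` for the average link capacities of `mixedAction`. -/
lemma weight_mixedAction_ge (n : ℕ) (κ l : ℝ) (x : Fin 2 → ∀ k : ℕ, (Fin k → Feedback) → ℝ)
    (b s : ∀ k : ℕ, (Fin k → Feedback) → ℝ) (j : Fin 2) (r ε : ℝ)
    (hb : ∀ k z, 0 ≤ b k z) (hx0 : ∀ k z, 0 ≤ x j k z) (hx1 : ∀ k z, x j k z ≤ 1)
    (hrev : ∀ k z, 1 - x j.rev k z = x j k z - b k z + s k z)
    (hκ0 : 0 ≤ κ) (hκ1 : κ ≤ 1) (hl0 : 0 ≤ l) (hl1 : l ≤ 1)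
    (hlE : l * H.slotExp n (fun k z w => receivedSome w * b k z) ≤
      H.slotExp n (fun k z w => receivedSome w * s k z))
    (hlM : l * H.slotExp n (fun k z w => receivedSome w * b k z) =
      H.slotExp n (fun k z w => receivedSome w * s k z) ∨ l = 1)
    (hε : 0 ≤ ε) (hX : r + ε ≤ (1 - κ) * H.slotExp n (fun k z w => received j w * x j k z))
    (hY : r + ε ≤
      (1 - κ) * H.slotExp n (fun k z w => receivedSome w * (1 - x j.rev k z)))
    (hU : ε ≤ κ / 2 * H.slotExp n (fun k z w => received j w * x j k z)) (q : QueueState) :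
    r * q j .one + ε / 3 * ∑ l, (q j l : ℝ) ≤ ∑ e, diffBacklog q j e * H.slotExp n
      (fun k z w => meanCapacity (mixedAction κ l (fun i => x i k z) (b k z) (s k z)) j e w) := by
  obtain ⟨c, hc⟩ : ∃ c : Link → ℝ, ∀ e, c e = H.slotExp n (fun k z w =>
    meanCapacity (mixedAction κ l (fun i => x i k z) (b k z) (s k z)) j e w) := ⟨_, fun _ => rfl⟩
  simp only [← hc]
  have hYe : H.slotExp n (fun k z w => receivedSome w * (1 - x j.rev k z)) =
      H.slotExp n (fun k z w => receivedSome w * x j k z) -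
      H.slotExp n (fun k z w => receivedSome w * b k z) +
      H.slotExp n (fun k z w => receivedSome w * s k z) := by
    rw [← map_sub, ← map_add]
    refine congrArg _ ?_
    ext k z w
    simp only [hrev, Pi.add_apply, Pi.sub_apply]
    ring
  have hDE : H.slotExp n (fun k z w => received j w * b k z) ≤
      H.slotExp n (fun k z w => receivedSome w * b k z) :=
    H.slotExp_mono n fun k z w => mul_le_mul_of_nonneg_right (received_le j w) (hb k z)
  have hD0 : 0 ≤ H.slotExp n (fun k z w => received j w * b k z) :=
    H.slotExp_nonneg n fun k z w => mul_nonneg (received_nonneg j w) (hb k z)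
  have hXV : H.slotExp n (fun k z w => received j w * x j k z) ≤
      H.slotExp n (fun k z w => receivedSome w * x j k z) :=
    H.slotExp_mono n fun k z w => mul_le_mul_of_nonneg_right (received_le j w) (hx0 k z)
  have hXU : H.slotExp n (fun k z w => received j w * x j k z) ≤
      H.slotExp n (fun _ _ w => received j w) :=
    H.slotExp_mono n fun k z w => mul_le_of_le_one_right (received_nonneg j w) (hx1 k z)
  have hUV : H.slotExp n (fun _ _ w => received j w) ≤ H.slotExp n (fun _ _ w => receivedSome w) :=
    H.slotExp_mono n fun k z w => received_le j w
  have c14 : c .l14 = (1 - κ) * (H.slotExp n (fun k z w => received j w * x j k z) -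
      H.slotExp n (fun k z w => received j w * b k z)) := by
    rw [hc, ← smul_eq_mul, ← map_sub, ← map_smul]
    refine congrArg _ ?_
    ext k z w
    simp only [meanCapacity_eq, Pi.smul_apply, Pi.sub_apply, smul_eq_mul, mixedAction]
    ring
  have c12 : c .l12 = (1 - κ) * ((H.slotExp n (fun k z w => receivedSome w * x j k z) -
      H.slotExp n (fun k z w => receivedSome w * b k z)) -
      (H.slotExp n (fun k z w => received j w * x j k z) -
      H.slotExp n (fun k z w => received j w * b k z))) := by
    rw [hc, ← smul_eq_mul, ← map_sub, ← map_sub, ← map_sub, ← map_smul]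
    refine congrArg _ ?_
    ext k z w
    simp only [meanCapacity_eq, Pi.smul_apply, Pi.sub_apply, smul_eq_mul, mixedAction]
    ring
  have c13 : c .l13 = (1 - κ) * H.slotExp n (fun k z w => receivedSome w * s k z) := by
    rw [hc, ← smul_eq_mul, ← map_smul]
    refine congrArg _ ?_
    ext k z w
    simp only [meanCapacity_eq, Pi.smul_apply, smul_eq_mul, mixedAction]
    ring
  have c24 : c .l24 = ((1 - κ) * (1 - l)) * H.slotExp n (fun k z w => received j w * b k z) +
      (κ / 2) * H.slotExp n (fun _ _ w => received j w) := by
    rw [hc, ← smul_eq_mul, ← smul_eq_mul (κ / 2), ← map_smul, ← map_smul, ← map_add]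
    refine congrArg _ ?_
    ext k z w
    simp only [meanCapacity_eq, Pi.smul_apply, Pi.add_apply, smul_eq_mul, mixedAction]
    ring
  have c34 : c .l34 = ((1 - κ) * l) * H.slotExp n (fun k z w => received j w * b k z) +
      (κ / 2) * H.slotExp n (fun _ _ w => received j w) := by
    rw [hc, ← smul_eq_mul, ← smul_eq_mul (κ / 2), ← map_smul, ← map_smul, ← map_add]
    refine congrArg _ ?_
    ext k z w
    simp only [meanCapacity_eq, Pi.smul_apply, Pi.add_apply, smul_eq_mul, mixedAction]
    ring
  have c32 : c .l32 = ((1 - κ) * l) * (H.slotExp n (fun k z w => receivedSome w * b k z) -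
      H.slotExp n (fun k z w => received j w * b k z)) +
      (κ / 2) * (H.slotExp n (fun _ _ w => receivedSome w) -
      H.slotExp n (fun _ _ w => received j w)) := by
    rw [hc, ← smul_eq_mul, ← smul_eq_mul (κ / 2), ← map_sub, ← map_sub, ← map_smul,
      ← map_smul, ← map_add]
    refine congrArg _ ?_
    ext k z w
    simp only [meanCapacity_eq, Pi.smul_apply, Pi.add_apply, Pi.sub_apply, smul_eq_mul,
      mixedAction]
    ring
  rw [hYe] at hY
  clear hYe hc
  generalize H.slotExp n (fun k z w => received j w * x j k z) = X at *
  generalize H.slotExp n (fun k z w => received j w * b k z) = D at *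
  generalize H.slotExp n (fun k z w => receivedSome w * x j k z) = VX at *
  generalize H.slotExp n (fun k z w => receivedSome w * b k z) = E at *
  generalize H.slotExp n (fun k z w => receivedSome w * s k z) = M at *
  generalize H.slotExp n (fun _ _ w => received j w) = U at *
  generalize H.slotExp n (fun _ _ w => receivedSome w) = V at *
  have k1 : 0 ≤ 1 - κ := by linarith
  have hlD : (1 - κ) * (l * D) ≤ (1 - κ) * (l * E) :=
    mul_le_mul_of_nonneg_left (mul_le_mul_of_nonneg_left hDE hl0) k1
  have hlE' : (1 - κ) * (l * E) ≤ (1 - κ) * M := mul_le_mul_of_nonneg_left hlE k1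
  have hκU : κ / 2 * X ≤ κ / 2 * U := mul_le_mul_of_nonneg_left hXU (by linarith)
  have hκV : κ / 2 * U ≤ κ / 2 * V := mul_le_mul_of_nonneg_left hUV (by linarith)
  have hXV' : (1 - κ) * X ≤ (1 - κ) * VX := mul_le_mul_of_nonneg_left hXV k1
  have hD1 : 0 ≤ (1 - κ) * (l * D) := mul_nonneg k1 (mul_nonneg hl0 hD0)
  have hD2 : 0 ≤ (1 - κ) * ((1 - l) * D) :=
    mul_nonneg k1 (mul_nonneg (sub_nonneg.2 hl1) hD0)
  refine weight_ge_of_cuts c r ε hε ?_ ?_ ?_ ?_ ?_ ?_ ?_ q j <;>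
    simp only [c12, c13, c14, c24, c32, c34]
  · linarith
  · linarith
  · rcases hlM with h | rfl
    · have h' : (1 - κ) * (l * E) = (1 - κ) * M := by rw [h]
      linarith
    · linarith
  all_goals linarith

/-- A rate pair in the interior of the outer region is supported by a randomized policy that
knows only a bounded number of past feedback samples: its average link capacities
dominate every max-weight problem with a slack. -/
lemma exists_policy (R : Fin 2 → ℝ) (hR0 : ∀ j, 0 ≤ R j) (δ : ℝ) (hδ : 0 < δ)
    (hR : (R 0 + δ, R 1 + δ) ∈ H.outerRegion) :
    (∀ j, R j ≤ 1) ∧ ∃ n : ℕ, 0 < n ∧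
      ∃ pol : ∀ k : ℕ, (Fin k → Feedback) → SlotAction → ℝ,
      (∀ k z a, 0 ≤ pol k z a) ∧ (∀ k z, ∑ a, pol k z a = 1) ∧
      ∃ ε > 0, ∀ q : QueueState, ∑ j, R j * (q j .one : ℝ) + ε * totalBacklog q ≤
        ∑ j, ∑ e, diffBacklog q j e *
          H.slotExp n (fun k z w => meanCapacity (pol k z) j e w) := by
  obtain ⟨n, x, hx, hX, hY⟩ := H.exists_slots_of_mem_outerRegion R δ hδ hR
  have hone : ∀ j, H.slotExp n (fun k z w => received j w * x j k z) ≤ 1 := fun j =>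
    (H.slotExp_mono n fun k z w => mul_le_one₀ (received_le_one j w) (hx j k z).1
      (hx j k z).2).trans (H.slotExp_one_le n)
  have hR1 : ∀ j, R j + δ / 2 ≤ 1 := fun j => (hX j).trans (hone j)
  have hn : 0 < n := by
    rcases Nat.eq_zero_or_pos n with rfl | h
    · have := hX 0
      rw [slotExp_apply] at this
      simp at this
      linarith [hR0 0]
    · exact h
  refine ⟨fun j => by linarith [hR1 j], n, hn, ?_⟩
  set b : ∀ k : ℕ, (Fin k → Feedback) → ℝ := fun k z => max (x 0 k z + x 1 k z - 1) 0 with hb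
  set s : ∀ k : ℕ, (Fin k → Feedback) → ℝ := fun k z => b k z - (x 0 k z + x 1 k z - 1) with hs
  have hb0 : ∀ k z, 0 ≤ b k z := fun k z => le_max_right _ _
  have hs0 : ∀ k z, 0 ≤ s k z := fun k z => sub_nonneg.2 (le_max_left _ _)
  have hbx : ∀ j k z, b k z ≤ x j k z := fun j k z => by
    have h0 := hx 0 k z
    have h1 := hx 1 k z
    refine max_le ?_ (hx j k z).1
    fin_cases j
    · change _ ≤ x 0 k z
      linarith [h1.2]
    · change _ ≤ x 1 k z
      linarith [h0.2]
  have hrev : ∀ j k z, 1 - x j.rev k z = x j k z - b k z + s k z := fun j k z => by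
    fin_cases j
    · change 1 - x 1 k z = x 0 k z - b k z + s k z
      simp only [hs]; ring
    · change 1 - x 0 k z = x 1 k z - b k z + s k z
      simp only [hs]; ring
  have hv0 : ∀ w, 0 ≤ receivedSome w := fun w => (received_nonneg 0 w).trans (received_le 0 w)
  obtain ⟨l, hl0, hl1, hlE, hlM⟩ := exists_split
    (H.slotExp_nonneg n fun k z w => mul_nonneg (hv0 w) (hb0 k z))
    (H.slotExp_nonneg n fun k z w => mul_nonneg (hv0 w) (hs0 k z))
  set κ := δ / 4 with hκ
  have hκ0 : 0 < κ := by positivity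
  have hκ1 : κ ≤ 1 := by linarith [hR1 0, hR0 0]
  refine ⟨fun k z => mixedAction κ l (fun i => x i k z) (b k z) (s k z), ?_, ?_,
    κ * (δ / 4) / 3, by positivity, fun q => ?_⟩
  · intro k z a
    have h1 : 0 ≤ 1 - κ := by linarith
    have h2 : 0 ≤ 1 - l := by linarith
    have h3 := hb0 k z
    have h4 := hs0 k z
    cases a with
    | uncoded j => exact mul_nonneg h1 (sub_nonneg.2 (hbx j k z))
    | coded => simp only [mixedAction]; positivity
    | poison => simp only [mixedAction]; positivity
    | remedy => simp only [mixedAction]; positivity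
  · intro k z
    rw [SlotAction.sum_univ]
    simp only [mixedAction, hs]
    ring
  rw [totalBacklog, Finset.mul_sum, ← Finset.sum_add_distrib]
  refine Finset.sum_le_sum fun j _ => ?_
  -- after the mixing with the weight `κ`, the rate `R j + δ / 2 ≤ 1` still leaves a slack
  have hmix : ∀ {a : ℝ}, R j + δ / 2 ≤ a → R j + κ * (δ / 4) ≤ (1 - κ) * a := by
    intro a ha
    have h1 : (1 - κ) * (R j + δ / 2) ≤ (1 - κ) * a :=
      mul_le_mul_of_nonneg_left ha (by linarith)
    have h2 : κ * (R j + δ / 2) ≤ κ * 1 := mul_le_mul_of_nonneg_left (hR1 j) hκ0.le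
    have h3 : κ * (δ / 4) ≤ 1 * (δ / 4) := mul_le_mul_of_nonneg_right hκ1 (by positivity)
    linarith
  refine H.weight_mixedAction_ge n κ l x b s j (R j) (κ * (δ / 4)) hb0 (fun k z => (hx j k z).1)
    (fun k z => (hx j k z).2) (hrev j) hκ0.le hκ1 hl0 hl1 hlE hlM (by positivity) (hmix (hX j))
    (hmix (hY j)) ?_ q
  have : κ / 2 * (δ / 2) ≤
      κ / 2 * H.slotExp n (fun k z w => received j w * x j k z) :=
    mul_le_mul_of_nonneg_left (by linarith [hX j, hR0 j]) (by linarith)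
  linarith

end ErasureChannel

/-! ### Integrals over countable partitions -/

section Atoms

variable {Ω κ : Type*} [MeasurableSpace Ω] [Countable κ] {Y : Ω → κ}

lemma measurable_of_factorsThrough (hY : ∀ y, MeasurableSet (Y ⁻¹' {y})) {β : Type*}
    [MeasurableSpace β] {F : Ω → β} (hF : Function.FactorsThrough F Y) : Measurable F := by
  intro A _
  have h : F ⁻¹' A = ⋃ y ∈ Y '' (F ⁻¹' A), Y ⁻¹' {y} := by
    ext ω
    simp only [Set.mem_iUnion, Set.mem_image, Set.mem_preimage, Set.mem_singleton_iff]
    constructor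
    · exact fun h => ⟨Y ω, ⟨ω, h, rfl⟩, rfl⟩
    · rintro ⟨y, ⟨ω', h', rfl⟩, hy⟩
      rwa [hF hy]
  rw [h]
  exact MeasurableSet.biUnion (Set.to_countable _) fun y _ => hY y

lemma hasSum_setIntegral_atoms (μ : Measure Ω) (hY : ∀ y, MeasurableSet (Y ⁻¹' {y})) {f : Ω → ℝ}
    (hf : Integrable f μ) : HasSum (fun y => ∫ ω in Y ⁻¹' {y}, f ω ∂μ) (∫ ω, f ω ∂μ) := by
  have h := hasSum_integral_iUnion (μ := μ) (f := f) hY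
    (fun y y' hne => Set.disjoint_left.2 fun ω h h' => hne (by
      simp only [Set.mem_preimage, Set.mem_singleton_iff] at h h'; rw [← h, ← h']))
    hf.integrableOn
  rwa [show ⋃ y, Y ⁻¹' {y} = Set.univ from Set.eq_univ_of_forall fun ω =>
    Set.mem_iUnion.2 ⟨Y ω, rfl⟩, setIntegral_univ] at h

lemma integral_le_of_atoms (μ : Measure Ω) (hY : ∀ y, MeasurableSet (Y ⁻¹' {y})) {f g : Ω → ℝ}
    (hf : Integrable f μ) (hg : Integrable g μ)
    (h : ∀ ω, ∫ ω' in Y ⁻¹' {Y ω}, f ω' ∂μ ≤ ∫ ω' in Y ⁻¹' {Y ω}, g ω' ∂μ) :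
    ∫ ω, f ω ∂μ ≤ ∫ ω, g ω ∂μ := by
  refine hasSum_le (fun y => ?_) (hasSum_setIntegral_atoms μ hY hf)
    (hasSum_setIntegral_atoms μ hY hg)
  by_cases hy : ∃ ω, Y ω = y
  · obtain ⟨ω, rfl⟩ := hy
    exact h ω
  · have : Y ⁻¹' {y} = ∅ := Set.eq_empty_of_forall_notMem fun ω hω => hy ⟨ω, hω⟩
    simp [this]

lemma integral_eq_of_atoms (μ : Measure Ω) (hY : ∀ y, MeasurableSet (Y ⁻¹' {y})) {f g : Ω → ℝ}
    (hf : Integrable f μ) (hg : Integrable g μ)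
    (h : ∀ ω, ∫ ω' in Y ⁻¹' {Y ω}, f ω' ∂μ = ∫ ω' in Y ⁻¹' {Y ω}, g ω' ∂μ) :
    ∫ ω, f ω ∂μ = ∫ ω, g ω ∂μ :=
  le_antisymm (integral_le_of_atoms μ hY hf hg fun ω => (h ω).le)
    (integral_le_of_atoms μ hY hg hf fun ω => (h ω).ge)

end Atoms

/-! ### The Markov property of the network -/

lemma bernoulliMass_nonneg {r : ℝ} (h0 : 0 ≤ r) (h1 : r ≤ 1) (b : Bool) :
    0 ≤ bernoulliMass r b := by
  unfold bernoulliMass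
  split_ifs <;> linarith

lemma sum_bernoulliMass_mul (R₁ R₂ : ℝ) (f : (Fin 2 → Bool) → ℝ) :
    ∑ b : Fin 2 → Bool, bernoulliMass R₁ (b 0) * bernoulliMass R₂ (b 1) * f b =
      R₁ * R₂ * f ![true, true] + R₁ * (1 - R₂) * f ![true, false] +
        (1 - R₁) * R₂ * f ![false, true] + (1 - R₁) * (1 - R₂) * f ![false, false] := by
  rw [Feedback.sum_univ]
  simp [bernoulliMass]

section Network

variable {S : Type*} {Ω : Type*} {St : ℕ → Ω → S} {Z : ℕ → Ω → Feedback}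
  {B : ℕ → Ω → Fin 2 → Bool} {Q : ℕ → Ω → QueueState}

/-- What has happened up to the end of slot `t`: the initial queue state and the channel states,
erasures and arrivals up to slot `t`. -/
def history (St : ℕ → Ω → S) (Z : ℕ → Ω → Feedback) (B : ℕ → Ω → Fin 2 → Bool)
    (Q : ℕ → Ω → QueueState) (t : ℕ) (ω : Ω) :
    QueueState × S × (Fin t → S × Feedback × (Fin 2 → Bool)) :=
  (Q 1 ω, St 0 ω, fun i => (St (i + 1) ω, Z (i + 1) ω, B (i + 1) ω))

lemma history_eq_iff {t : ℕ} {ω ω' : Ω} :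
    history St Z B Q t ω = history St Z B Q t ω' ↔ Q 1 ω = Q 1 ω' ∧ St 0 ω = St 0 ω' ∧
      ∀ i ∈ Finset.Icc 1 t, St i ω = St i ω' ∧ Z i ω = Z i ω' ∧ B i ω = B i ω' := by
  simp only [history, Prod.mk.injEq, funext_iff (α := Fin t), Finset.mem_Icc]
  refine and_congr_right fun _ => and_congr_right fun _ => ⟨fun h i hi => ?_, fun h i => ?_⟩
  · have := h ⟨i - 1, by omega⟩
    simpa only [Nat.sub_add_cancel hi.1] using this
  · exact h (i + 1) ⟨by omega, by omega⟩

/-- The history determines everything that depends on a part of it. -/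
lemma factorsThrough_history_mono {β : Type*} {F : Ω → β} {t t' : ℕ} (h : t ≤ t')
    (hF : Function.FactorsThrough F (history St Z B Q t)) :
    Function.FactorsThrough F (history St Z B Q t') := by
  intro ω ω' he
  rw [history_eq_iff] at he
  refine hF (history_eq_iff.2 ⟨he.1, he.2.1, fun i hi => he.2.2 i ?_⟩)
  rw [Finset.mem_Icc] at *
  omega

lemma factorsThrough_step (t : ℕ) {β : Type*} (G : S → Feedback → (Fin 2 → Bool) → β) :
    Function.FactorsThrough (fun ω => G (St (t + 1) ω) (Z (t + 1) ω) (B (t + 1) ω))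
      (history St Z B Q (t + 1)) := by
  intro ω ω' he
  rw [history_eq_iff] at he
  obtain ⟨h1, h2, h3⟩ := he.2.2 (t + 1) (by simp)
  simp only [h1, h2, h3]

lemma factorsThrough_state (t : ℕ) {β : Type*} (G : S → β) :
    Function.FactorsThrough (fun ω => G (St t ω)) (history St Z B Q t) := by
  cases t with
  | zero =>
    intro ω ω' he
    rw [history_eq_iff] at he
    simp only [he.2.1]
  | succ t => exact factorsThrough_step t fun s _ _ => G s

end Network

namespace IsMaxWeightNetwork

variable {S : Type*} [Fintype S] [DecidableEq S] {H : ErasureChannel S} {R₁ R₂ : ℝ}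
  {Ω : Type*} [MeasurableSpace Ω] {μ : Measure Ω}
  {St : ℕ → Ω → S} {Z : ℕ → Ω → Feedback} {B : ℕ → Ω → Fin 2 → Bool}
  {A : ℕ → Ω → SlotAction} {Q : ℕ → Ω → QueueState}

lemma measurableSet_history (hnet : IsMaxWeightNetwork H R₁ R₂ μ St Z B A Q) (t : ℕ)
    (y : QueueState × S × (Fin t → S × Feedback × (Fin 2 → Bool))) :
    MeasurableSet (history St Z B Q t ⁻¹' {y}) := by
  obtain ⟨q, s, x⟩ := y
  have h : history St Z B Q t ⁻¹' {(q, s, x)} = {ω | Q 1 ω = q} ∩ {ω | St 0 ω = s} ∩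
      ⋂ i : Fin t, {ω | St (i + 1) ω = (x i).1} ∩ {ω | Z (i + 1) ω = (x i).2.1} ∩
        {ω | B (i + 1) ω = (x i).2.2} := by
    ext ω
    simp only [history, Set.mem_preimage, Set.mem_singleton_iff, Prod.ext_iff, Set.mem_inter_iff,
      Set.mem_ofPred_eq, Set.mem_iInter, funext_iff (α := Fin t), and_assoc]
  rw [h]
  exact ((hnet.measurable_init q).inter (hnet.measurable_state 0 s)).inter
    (MeasurableSet.iInter fun i => ((hnet.measurable_state _ _).inter
      (hnet.measurable_feedback _ _)).inter (hnet.measurable_arrival _ _))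

lemma measurable_of_history (hnet : IsMaxWeightNetwork H R₁ R₂ μ St Z B A Q) {t : ℕ} {β : Type*}
    [MeasurableSpace β] {F : Ω → β} (hF : Function.FactorsThrough F (history St Z B Q t)) :
    Measurable F :=
  measurable_of_factorsThrough (hnet.measurableSet_history t) hF

lemma integrable_mul_of_history [IsFiniteMeasure μ]
    (hnet : IsMaxWeightNetwork H R₁ R₂ μ St Z B A Q) {t : ℕ} {F φ : Ω → ℝ}
    (hF : Integrable F μ) (hφ : Function.FactorsThrough φ (history St Z B Q t))
    {C : ℝ} (hC : ∀ ω, |φ ω| ≤ C) : Integrable (fun ω => F ω * φ ω) μ :=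
  hF.mul_bdd (c := C) (hnet.measurable_of_history hφ).aestronglyMeasurable
    (ae_of_all _ fun ω => by simpa using hC ω)

/-- Given the history up to slot `t`, the next state, erasures and arrivals have the law
given by the channel and the arrival rates. -/
lemma measureReal_history_step [IsFiniteMeasure μ]
    (hnet : IsMaxWeightNetwork H R₁ R₂ μ St Z B A Q)
    (h1 : 0 ≤ R₁ ∧ R₁ ≤ 1) (h2 : 0 ≤ R₂ ∧ R₂ ≤ 1) (t : ℕ) (ω₀ : Ω) (s : S) (z : Feedback)
    (b : Fin 2 → Bool) :
    μ.real (history St Z B Q t ⁻¹' {history St Z B Q t ω₀} ∩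
        {ω | St (t + 1) ω = s ∧ Z (t + 1) ω = z ∧ B (t + 1) ω = b}) =
      μ.real (history St Z B Q t ⁻¹' {history St Z B Q t ω₀}) *
        (H.P (St t ω₀) s * H.W s z * (bernoulliMass R₁ (b 0) * bernoulliMass R₂ (b 1))) := by
  set s' : ℕ → S := Function.update (fun i => St i ω₀) (t + 1) s with hs'
  set z' : ℕ → Feedback := Function.update (fun i => Z i ω₀) (t + 1) z with hz'
  set b' : ℕ → Fin 2 → Bool := Function.update (fun i => B i ω₀) (t + 1) b with hb'
  have hs : ∀ i, i ≠ t + 1 → s' i = St i ω₀ := fun i hi => Function.update_of_ne hi _ _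
  have hz : ∀ i, i ≠ t + 1 → z' i = Z i ω₀ := fun i hi => Function.update_of_ne hi _ _
  have hb : ∀ i, i ≠ t + 1 → b' i = B i ω₀ := fun i hi => Function.update_of_ne hi _ _
  have hs1 : s' (t + 1) = s := Function.update_self _ _ _
  have hz1 : z' (t + 1) = z := Function.update_self _ _ _
  have hb1 : b' (t + 1) = b := Function.update_self _ _ _
  have e1 : history St Z B Q t ⁻¹' {history St Z B Q t ω₀} =
      {ω | Q 1 ω = Q 1 ω₀ ∧ St 0 ω = s' 0 ∧
        ∀ i ∈ Finset.Icc 1 t, St i ω = s' i ∧ Z i ω = z' i ∧ B i ω = b' i} := by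
    ext ω
    rw [Set.mem_preimage, Set.mem_singleton_iff, history_eq_iff, Set.mem_ofPred_eq, hs 0 (by omega)]
    refine and_congr_right fun _ => and_congr_right fun _ => forall₂_congr fun i hi => ?_
    rw [Finset.mem_Icc] at hi
    rw [hs i (by omega), hz i (by omega), hb i (by omega)]
  have e2 : history St Z B Q t ⁻¹' {history St Z B Q t ω₀} ∩
      {ω | St (t + 1) ω = s ∧ Z (t + 1) ω = z ∧ B (t + 1) ω = b} =
      {ω | Q 1 ω = Q 1 ω₀ ∧ St 0 ω = s' 0 ∧
        ∀ i ∈ Finset.Icc 1 (t + 1), St i ω = s' i ∧ Z i ω = z' i ∧ B i ω = b' i} := by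
    rw [e1]
    ext ω
    simp only [Set.mem_inter_iff, Set.mem_ofPred_eq, Finset.forall_mem_insert, hs1, hz1, hb1,
      ← Finset.insert_Icc_right_eq_Icc_add_one (show 1 ≤ t + 1 by omega)]
    tauto
  have hprod : ∀ (n : ℕ), 0 ≤ H.π (s' 0) * ∏ i ∈ Finset.Icc 1 n,
      H.P (s' (i - 1)) (s' i) * H.W (s' i) (z' i) *
        (bernoulliMass R₁ (b' i 0) * bernoulliMass R₂ (b' i 1)) := fun n =>
    mul_nonneg (H.π_nonneg _) (Finset.prod_nonneg fun i _ => mul_nonneg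
      (mul_nonneg (H.P_nonneg _ _) (H.W_nonneg _ _))
      (mul_nonneg (bernoulliMass_nonneg h1.1 h1.2 _) (bernoulliMass_nonneg h2.1 h2.2 _)))
  rw [e2, e1, Measure.real, Measure.real, hnet.law, hnet.law, ENNReal.toReal_mul,
    ENNReal.toReal_mul, ENNReal.toReal_ofReal (hprod _), ENNReal.toReal_ofReal (hprod _),
    Finset.prod_Icc_succ_top (by omega), hs1, hz1, hb1, Nat.add_sub_cancel, hs t (by omega)]
  ring

/-- One step of the Markov property: what depends on the past may be taken out of the
conditional expectation of a function of the next state, erasures and arrivals. -/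
lemma integral_mul_step [IsFiniteMeasure μ]
    (hnet : IsMaxWeightNetwork H R₁ R₂ μ St Z B A Q)
    (h1 : 0 ≤ R₁ ∧ R₁ ≤ 1) (h2 : 0 ≤ R₂ ∧ R₂ ≤ 1) (t : ℕ) {F : Ω → ℝ} (hFi : Integrable F μ)
    (hF : Function.FactorsThrough F (history St Z B Q t))
    (G : S → Feedback → (Fin 2 → Bool) → ℝ) :
    ∫ ω, F ω * G (St (t + 1) ω) (Z (t + 1) ω) (B (t + 1) ω) ∂μ =
      ∫ ω, F ω * ∑ s, ∑ z, ∑ b, H.P (St t ω) s * H.W s z *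
        (bernoulliMass R₁ (b 0) * bernoulliMass R₂ (b 1)) * G s z b ∂μ := by
  have hbdd : ∀ {α : Type _} [Finite α] (g : α → ℝ), ∃ C, ∀ a, |g a| ≤ C := by
    intro α _ g
    obtain ⟨C, hC⟩ := (Set.finite_range fun a => |g a|).bddAbove
    exact ⟨C, fun a => hC ⟨a, rfl⟩⟩
  obtain ⟨C, hC⟩ := hbdd fun x : S × Feedback × (Fin 2 → Bool) => G x.1 x.2.1 x.2.2
  obtain ⟨C', hC'⟩ := hbdd fun x : S => ∑ s, ∑ z, ∑ b, H.P x s * H.W s z *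
        (bernoulliMass R₁ (b 0) * bernoulliMass R₂ (b 1)) * G s z b
  refine integral_eq_of_atoms μ (hnet.measurableSet_history t)
    (hnet.integrable_mul_of_history hFi (factorsThrough_step t G)
      (fun ω => hC (St (t + 1) ω, Z (t + 1) ω, B (t + 1) ω)))
    (hnet.integrable_mul_of_history hFi (factorsThrough_state t fun x => ∑ s, ∑ z, ∑ b,
      H.P x s * H.W s z * (bernoulliMass R₁ (b 0) * bernoulliMass R₂ (b 1)) * G s z b)
      (fun ω => hC' (St t ω))) fun ω₀ => ?_
  set T := history St Z B Q t ⁻¹' {history St Z B Q t ω₀} with hT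
  have hTm : MeasurableSet T := hnet.measurableSet_history t _
  have hr : ∫ ω in T, F ω * ∑ s, ∑ z, ∑ b, H.P (St t ω) s * H.W s z *
        (bernoulliMass R₁ (b 0) * bernoulliMass R₂ (b 1)) * G s z b ∂μ =
      ∫ ω in T, F ω₀ * ∑ s, ∑ z, ∑ b, H.P (St t ω₀) s * H.W s z *
        (bernoulliMass R₁ (b 0) * bernoulliMass R₂ (b 1)) * G s z b ∂μ := by
    refine setIntegral_congr_fun hTm fun ω hω => ?_
    have e1 : F ω = F ω₀ := hF hω
    have e2 : St t ω = St t ω₀ := factorsThrough_state t id hω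
    simp only [e1, e2]
  have hl : ∫ ω in T, F ω * G (St (t + 1) ω) (Z (t + 1) ω) (B (t + 1) ω) ∂μ =
      ∫ ω in T, F ω₀ * ∑ s, ∑ z, ∑ b, G s z b * Set.indicator
        {ω | St (t + 1) ω = s ∧ Z (t + 1) ω = z ∧ B (t + 1) ω = b} (fun _ => (1 : ℝ)) ω ∂μ := by
    refine setIntegral_congr_fun hTm fun ω hω => ?_
    have e1 : F ω = F ω₀ := hF hω
    simp only [e1, Set.indicator_apply, Set.mem_ofPred_eq, mul_ite, mul_one, mul_zero, ite_and]
    simp [Finset.sum_ite_irrel]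
  have hm : ∀ s z b, MeasurableSet
      {ω | St (t + 1) ω = s ∧ Z (t + 1) ω = z ∧ B (t + 1) ω = b} := fun s z b =>
    (hnet.measurable_state _ s).inter
      ((hnet.measurable_feedback _ z).inter (hnet.measurable_arrival _ b))
  have hi : ∀ s z b, Integrable (fun ω => G s z b * Set.indicator
        {ω | St (t + 1) ω = s ∧ Z (t + 1) ω = z ∧ B (t + 1) ω = b} (fun _ => (1 : ℝ)) ω)
        (μ.restrict T) := fun s z b =>
    ((integrable_const (1 : ℝ)).indicator (hm s z b)).const_mul _
  rw [hr, hl, setIntegral_const, integral_const_mul, smul_eq_mul,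
    integral_finsetSum _ fun s _ => integrable_finsetSum _ fun z _ =>
      integrable_finsetSum _ fun b _ => hi s z b]
  rw [mul_left_comm]
  refine congrArg (F ω₀ * ·) ?_
  rw [Finset.mul_sum]
  refine Finset.sum_congr rfl fun s _ => ?_
  rw [integral_finsetSum _ fun z _ => integrable_finsetSum _ fun b _ => hi s z b,
    Finset.mul_sum]
  refine Finset.sum_congr rfl fun z _ => ?_
  rw [integral_finsetSum _ fun b _ => hi s z b, Finset.mul_sum]
  refine Finset.sum_congr rfl fun b _ => ?_
  rw [integral_const_mul, integral_indicator (hm s z b), setIntegral_const, smul_eq_mul, mul_one,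
    measureReal_restrict_apply (hm s z b), Set.inter_comm,
    hnet.measureReal_history_step h1 h2]
  ring

lemma integral_mul_feedback_step [IsFiniteMeasure μ]
    (hnet : IsMaxWeightNetwork H R₁ R₂ μ St Z B A Q)
    (h1 : 0 ≤ R₁ ∧ R₁ ≤ 1) (h2 : 0 ≤ R₂ ∧ R₂ ≤ 1) (t : ℕ) {F : Ω → ℝ} (hFi : Integrable F μ)
    (hF : Function.FactorsThrough F (history St Z B Q t)) (G : S → Feedback → ℝ) :
    ∫ ω, F ω * G (St (t + 1) ω) (Z (t + 1) ω) ∂μ =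
      ∫ ω, F ω * ∑ s, H.P (St t ω) s * ∑ z, H.W s z * G s z ∂μ := by
  rw [hnet.integral_mul_step h1 h2 t hFi hF fun s z _ => G s z]
  refine integral_congr_ae (ae_of_all _ fun ω => congrArg (F ω * ·) ?_)
  refine Finset.sum_congr rfl fun s _ => ?_
  rw [Finset.mul_sum]
  refine Finset.sum_congr rfl fun z _ => ?_
  have hb : ∑ b : Fin 2 → Bool, bernoulliMass R₁ (b 0) * bernoulliMass R₂ (b 1) = 1 := by
    have := sum_bernoulliMass_mul R₁ R₂ fun _ => 1
    simp only [mul_one] at this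
    rw [this]
    ring
  rw [← Finset.sum_mul, ← Finset.mul_sum, hb]
  ring

lemma integral_mul_state_step [IsFiniteMeasure μ]
    (hnet : IsMaxWeightNetwork H R₁ R₂ μ St Z B A Q)
    (h1 : 0 ≤ R₁ ∧ R₁ ≤ 1) (h2 : 0 ≤ R₂ ∧ R₂ ≤ 1) (t : ℕ) {F : Ω → ℝ} (hFi : Integrable F μ)
    (hF : Function.FactorsThrough F (history St Z B Q t)) (g : S → ℝ) :
    ∫ ω, F ω * g (St (t + 1) ω) ∂μ = ∫ ω, F ω * ∑ s, H.P (St t ω) s * g s ∂μ := by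
  rw [hnet.integral_mul_feedback_step h1 h2 t hFi hF fun s _ => g s]
  simp only [← Finset.sum_mul, H.sum_W, one_mul]

lemma integral_mul_arrival [IsFiniteMeasure μ]
    (hnet : IsMaxWeightNetwork H R₁ R₂ μ St Z B A Q)
    (h1 : 0 ≤ R₁ ∧ R₁ ≤ 1) (h2 : 0 ≤ R₂ ∧ R₂ ≤ 1) (t : ℕ) {F : Ω → ℝ} (hFi : Integrable F μ)
    (hF : Function.FactorsThrough F (history St Z B Q t)) (j : Fin 2) :
    ∫ ω, F ω * (if B (t + 1) ω j = true then 1 else 0) ∂μ = ![R₁, R₂] j * ∫ ω, F ω ∂μ := by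
  rw [hnet.integral_mul_step h1 h2 t hFi hF fun _ _ b => if b j = true then 1 else 0,
    mul_comm, ← integral_mul_const]
  refine integral_congr_ae (ae_of_all _ fun ω => congrArg (F ω * ·) ?_)
  have hb : ∑ b : Fin 2 → Bool, bernoulliMass R₁ (b 0) * bernoulliMass R₂ (b 1) *
      (if b j = true then 1 else 0) = ![R₁, R₂] j := by
    rw [sum_bernoulliMass_mul]
    fin_cases j <;> simp <;> ring
  simp only [mul_assoc, ← Finset.mul_sum]
  simp only [← mul_assoc, hb, ← Finset.sum_mul, H.sum_W, mul_one, H.sum_P]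
  simp

/-- The Markov property for a whole window of feedback samples. -/
lemma integral_mul_window [IsFiniteMeasure μ]
    (hnet : IsMaxWeightNetwork H R₁ R₂ μ St Z B A Q)
    (h1 : 0 ≤ R₁ ∧ R₁ ≤ 1) (h2 : 0 ≤ R₂ ∧ R₂ ≤ 1) (k t : ℕ) {F : Ω → ℝ} (hFi : Integrable F μ)
    (hF : Function.FactorsThrough F (history St Z B Q t)) (r : (Fin k → Feedback) → ℝ) :
    ∫ ω, F ω * r (fun i => Z (t + 1 + i) ω) ∂μ = ∫ ω, F ω * H.obsExp k r (St t ω) ∂μ := by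
  induction k generalizing t F with
  | zero => simp only [ErasureChannel.obsExp, Subsingleton.elim _ (Fin.elim0 : Fin 0 → Feedback)]
  | succ k ih =>
    -- split according to the first sample `w` of the window
    have hind : ∀ w, Function.FactorsThrough (fun ω => if Z (t + 1) ω = w then (1 : ℝ) else 0)
        (history St Z B Q (t + 1)) := fun w =>
      factorsThrough_step t fun _ z _ => if z = w then (1 : ℝ) else 0
    have hFw : ∀ w, Integrable (fun ω => F ω * if Z (t + 1) ω = w then 1 else 0) μ := fun w =>
      hnet.integrable_mul_of_history hFi (hind w) (C := 1) fun ω => by split_ifs <;> simp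
    have hFw' : ∀ w, Function.FactorsThrough (fun ω => F ω * if Z (t + 1) ω = w then 1 else 0)
        (history St Z B Q (t + 1)) := fun w ω ω' he => by
      have e1 := factorsThrough_history_mono (Nat.le_succ t) hF he
      have e2 := hind w he
      simp only at e2
      simp only [e1, e2]
    have hwin : ∀ w, Integrable (fun ω => (F ω * if Z (t + 1) ω = w then 1 else 0) *
        r (Fin.cons w fun i : Fin k => Z (t + 1 + 1 + i) ω)) μ := by
      intro w
      obtain ⟨C, hC⟩ := (Set.finite_range fun z => |r z|).bddAbove
      refine hnet.integrable_mul_of_history (t := t + 1 + k) (hFw w) ?_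
        (fun ω => hC ⟨_, rfl⟩)
      intro ω ω' he
      rw [history_eq_iff] at he
      have : (fun i : Fin k => Z (t + 1 + 1 + i) ω) = fun i : Fin k => Z (t + 1 + 1 + i) ω' :=
        funext fun i => (he.2.2 _ (Finset.mem_Icc.2 ⟨by omega, by omega⟩)).2.1
      simp only [this]
    have hobs : ∀ w, Integrable (fun ω => (F ω * if Z (t + 1) ω = w then 1 else 0) *
        H.obsExp k (fun z => r (Fin.cons w z)) (St (t + 1) ω)) μ := by
      intro w
      obtain ⟨C, hC⟩ :=
        (Set.finite_range fun s => |H.obsExp k (fun z => r (Fin.cons w z)) s|).bddAbove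
      exact hnet.integrable_mul_of_history (hFw w) (factorsThrough_state _ _)
        (fun ω => hC ⟨_, rfl⟩)
    calc ∫ ω, F ω * r (fun i => Z (t + 1 + i) ω) ∂μ
        = ∫ ω, ∑ w, (F ω * if Z (t + 1) ω = w then 1 else 0) *
            r (Fin.cons w fun i : Fin k => Z (t + 1 + 1 + i) ω) ∂μ := by
          refine integral_congr_ae (ae_of_all _ fun ω => ?_)
          have e : (fun i : Fin (k + 1) => Z (t + 1 + i) ω) =
              Fin.cons (Z (t + 1) ω) fun i : Fin k => Z (t + 1 + 1 + i) ω := by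
            ext1 i
            refine Fin.cases ?_ (fun i => ?_) i
            · simp
            · rw [Fin.cons_succ, Fin.val_succ,
                show t + 1 + ((i : ℕ) + 1) = t + 1 + 1 + i by omega]
          simp only [e, mul_ite, mul_one, mul_zero, ite_mul, zero_mul, Finset.sum_ite_eq,
            Finset.mem_univ, if_true]
      _ = ∑ w, ∫ ω, (F ω * if Z (t + 1) ω = w then 1 else 0) *
            H.obsExp k (fun z => r (Fin.cons w z)) (St (t + 1) ω) ∂μ := by
          rw [integral_finsetSum _ fun w _ => hwin w]
          exact Finset.sum_congr rfl fun w _ =>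
            ih (t + 1) (hFw w) (hFw' w) fun z => r (Fin.cons w z)
      _ = ∫ ω, F ω * H.obsExp k (fun z => r (Fin.cons (Z (t + 1) ω) z)) (St (t + 1) ω) ∂μ := by
          rw [← integral_finsetSum _ fun w _ => hobs w]
          refine integral_congr_ae (ae_of_all _ fun ω => ?_)
          simp only [mul_ite, mul_one, mul_zero, ite_mul, zero_mul, Finset.sum_ite_eq,
            Finset.mem_univ, if_true]
      _ = ∫ ω, F ω * H.obsExp (k + 1) r (St t ω) ∂μ :=
          hnet.integral_mul_feedback_step h1 h2 t hFi hF
            fun s w => H.obsExp k (fun z => r (Fin.cons w z)) s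

/-! ### The queue process -/

lemma factorsThrough_queue (hnet : IsMaxWeightNetwork H R₁ R₂ μ St Z B A Q) (t : ℕ) :
    Function.FactorsThrough (Q (t + 1)) (history St Z B Q t) := by
  induction t with
  | zero => exact fun ω ω' he => (history_eq_iff.1 he).1
  | succ t ih =>
    obtain ⟨φ, hφ⟩ := hnet.action_causal
    intro ω ω' he
    have hq := factorsThrough_history_mono (Nat.le_succ t) ih he
    have hs := (history_eq_iff.1 he).2.2
    have hp : pastFeedback Z (t + 1) ω = pastFeedback Z (t + 1) ω' := by
      ext1 i
      exact (hs (i + 1) (Finset.mem_Icc.2 ⟨by omega, by omega⟩)).2.1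
    obtain ⟨-, hz, hb⟩ := hs (t + 1) (by simp)
    rw [hnet.queue_next (t + 1) (by omega), hnet.queue_next (t + 1) (by omega),
      hφ (t + 1) (by omega), hφ (t + 1) (by omega), hq, hp, hz, hb]

lemma abs_queue_sub_le (hnet : IsMaxWeightNetwork H R₁ R₂ μ St Z B A Q) (t k : ℕ) (ω : Ω)
    (j : Fin 2) (l : Buffer) : |(Q (t + 1 + k) ω j l : ℝ) - Q (t + 1) ω j l| ≤ 2 * k := by
  induction k with
  | zero => simp
  | succ k ih =>
    rw [← add_assoc, hnet.queue_next (t + 1 + k) (by omega)]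
    have h := abs_nextState_sub_le (Q (t + 1 + k) ω) (A (t + 1 + k) ω) (Z (t + 1 + k) ω)
      (B (t + 1 + k) ω) j l
    push_cast
    rw [abs_le] at *
    constructor <;> linarith

lemma measurable_queue (hnet : IsMaxWeightNetwork H R₁ R₂ μ St Z B A Q) (t : ℕ)
    (f : QueueState → ℝ) : Measurable fun ω => f (Q (t + 1) ω) :=
  hnet.measurable_of_history (t := t) fun _ _ he => congrArg f (hnet.factorsThrough_queue t he)

lemma integrable_queue_sq [IsFiniteMeasure μ] (hnet : IsMaxWeightNetwork H R₁ R₂ μ St Z B A Q)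
    (t : ℕ) (j : Fin 2) (l : Buffer) : Integrable (fun ω => (Q (t + 1) ω j l : ℝ) ^ 2) μ := by
  have h0 : Integrable (fun ω => (Q 1 ω j l : ℝ) ^ 2) μ := by
    refine ⟨(hnet.measurable_queue 0 fun q => (q j l : ℝ) ^ 2).aestronglyMeasurable,
      lt_of_le_of_lt (lintegral_mono fun ω => ?_) hnet.init_sq⟩
    have e : ‖(Q 1 ω j l : ℝ) ^ 2‖ₑ = (Q 1 ω j l : ENNReal) ^ 2 := by
      rw [enorm_pow]
      congr 1
      rw [Real.enorm_eq_ofReal (Nat.cast_nonneg _), ENNReal.ofReal_natCast]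
    rw [e]
    exact (Finset.single_le_sum (f := fun l => (Q 1 ω j l : ENNReal) ^ 2)
      (fun _ _ => zero_le) (Finset.mem_univ l)).trans
      (Finset.single_le_sum (f := fun j => ∑ l, (Q 1 ω j l : ENNReal) ^ 2)
      (fun _ _ => zero_le) (Finset.mem_univ j))
  refine Integrable.mono' ((h0.const_mul 2).add (integrable_const (2 * (2 * (t : ℝ)) ^ 2)))
    (hnet.measurable_queue t fun q => (q j l : ℝ) ^ 2).aestronglyMeasurable
    (ae_of_all _ fun ω => ?_)
  have h := hnet.abs_queue_sub_le 0 t ω j l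
  rw [zero_add, add_comm 1 t, abs_le] at h
  have h' := sq_le_sq' h.1 h.2
  rw [Real.norm_of_nonneg (sq_nonneg _)]
  simp only [Pi.add_apply]
  nlinarith [sq_nonneg ((Q (t + 1) ω j l : ℝ) - 2 * Q 1 ω j l)]

lemma integrable_queue [IsFiniteMeasure μ] (hnet : IsMaxWeightNetwork H R₁ R₂ μ St Z B A Q)
    (t : ℕ) (j : Fin 2) (l : Buffer) : Integrable (fun ω => (Q (t + 1) ω j l : ℝ)) μ := by
  refine Integrable.mono' ((hnet.integrable_queue_sq t j l).add (integrable_const 1))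
    (hnet.measurable_queue t fun q => (q j l : ℝ)).aestronglyMeasurable
    (ae_of_all _ fun ω => ?_)
  rw [Real.norm_of_nonneg (Nat.cast_nonneg _)]
  simp only [Pi.add_apply]
  nlinarith [sq_nonneg ((Q (t + 1) ω j l : ℝ) - 1)]

lemma integrable_diffBacklog [IsFiniteMeasure μ]
    (hnet : IsMaxWeightNetwork H R₁ R₂ μ St Z B A Q) (t : ℕ) (j : Fin 2) (e : Link) :
    Integrable (fun ω => diffBacklog (Q (t + 1) ω) j e) μ :=
  Integrable.mono' (hnet.integrable_queue t j e.src)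
    (hnet.measurable_queue t fun q => diffBacklog q j e).aestronglyMeasurable
    (ae_of_all _ fun ω => by
      rw [Real.norm_of_nonneg (diffBacklog_nonneg _ _ _)]; exact diffBacklog_le _ _ _)

lemma integrable_totalBacklog [IsFiniteMeasure μ]
    (hnet : IsMaxWeightNetwork H R₁ R₂ μ St Z B A Q) (t : ℕ) :
    Integrable (fun ω => totalBacklog (Q (t + 1) ω)) μ :=
  integrable_finsetSum _ fun j _ => integrable_finsetSum _ fun l _ => hnet.integrable_queue t j l

lemma integrable_sqBacklog [IsFiniteMeasure μ]
    (hnet : IsMaxWeightNetwork H R₁ R₂ μ St Z B A Q) (t : ℕ) :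
    Integrable (fun ω => sqBacklog (Q (t + 1) ω)) μ :=
  integrable_finsetSum _ fun j _ => integrable_finsetSum _ fun l _ =>
    hnet.integrable_queue_sq t j l

end IsMaxWeightNetwork

lemma sum_mul_slotWeight (p : SlotAction → ℝ) (q : QueueState) (z : Feedback) :
    ∑ a, p a * slotWeight q a z = ∑ j, ∑ e, diffBacklog q j e * meanCapacity p j e z := by
  unfold slotWeight meanCapacity
  simp only [Finset.mul_sum]
  rw [Finset.sum_comm]
  refine Finset.sum_congr rfl fun j _ => ?_
  rw [Finset.sum_comm]
  exact Finset.sum_congr rfl fun e _ => Finset.sum_congr rfl fun a _ => by ring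

namespace IsMaxWeightNetwork

variable {S : Type*} [Fintype S] [DecidableEq S] {H : ErasureChannel S} {R₁ R₂ : ℝ}
  {Ω : Type*} [MeasurableSpace Ω] {μ : Measure Ω}
  {St : ℕ → Ω → S} {Z : ℕ → Ω → Feedback} {B : ℕ → Ω → Fin 2 → Bool}
  {A : ℕ → Ω → SlotAction} {Q : ℕ → Ω → QueueState}

/-! ### The max-weight property -/

lemma factorsThrough_queue_feedback (hnet : IsMaxWeightNetwork H R₁ R₂ μ St Z B A Q) (t : ℕ) :
    Function.FactorsThrough (fun ω => (Q (t + 1) ω, pastFeedback Z (t + 1) ω))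
      (history St Z B Q t) := by
  intro ω ω' he
  have hp : pastFeedback Z (t + 1) ω = pastFeedback Z (t + 1) ω' := by
    ext1 i
    exact ((history_eq_iff.1 he).2.2 (i + 1) (Finset.mem_Icc.2 ⟨by omega, by omega⟩)).2.1
  simp only [hnet.factorsThrough_queue t he, hp]

lemma factorsThrough_action (hnet : IsMaxWeightNetwork H R₁ R₂ μ St Z B A Q) (t : ℕ) :
    Function.FactorsThrough (A (t + 1)) (history St Z B Q t) := by
  intro ω ω' he
  obtain ⟨φ, hφ⟩ := hnet.action_causal
  have h := hnet.factorsThrough_queue_feedback t he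
  rw [Prod.mk.injEq] at h
  rw [hφ (t + 1) (by omega), hφ (t + 1) (by omega), h.1, h.2]

lemma integrable_diffBacklog_mul_capacity [IsFiniteMeasure μ]
    (hnet : IsMaxWeightNetwork H R₁ R₂ μ St Z B A Q) (t : ℕ) (f : Ω → ℝ)
    (hf : Function.FactorsThrough f (history St Z B Q (t + 1)))
    (hf0 : ∀ ω, 0 ≤ f ω) (hf1 : ∀ ω, f ω ≤ 1) (j : Fin 2) (e : Link) :
    Integrable (fun ω => diffBacklog (Q (t + 1) ω) j e * f ω) μ :=
  hnet.integrable_mul_of_history (hnet.integrable_diffBacklog t j e) hf (C := 1)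
    fun ω => abs_le.2 ⟨by linarith [hf0 ω], hf1 ω⟩

lemma integrable_slotWeight [IsFiniteMeasure μ]
    (hnet : IsMaxWeightNetwork H R₁ R₂ μ St Z B A Q) (t : ℕ) (a : Ω → SlotAction)
    (ha : Function.FactorsThrough a (history St Z B Q t)) :
    Integrable (fun ω => slotWeight (Q (t + 1) ω) (a ω) (Z (t + 1) ω)) μ :=
  integrable_finsetSum _ fun j _ => integrable_finsetSum _ fun e _ =>
    hnet.integrable_diffBacklog_mul_capacity t _ (fun ω ω' he => by
      have hz := factorsThrough_step t (fun _ z _ => z) he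
      simp only at hz
      simp only [factorsThrough_history_mono (Nat.le_succ t) ha he, hz])
      (fun ω => Nat.cast_nonneg _) (fun ω => by exact_mod_cast capacity_le_one _ _ _ _) j e

lemma measurable_capacity (hnet : IsMaxWeightNetwork H R₁ R₂ μ St Z B A Q) (t : ℕ)
    (f : Feedback → ℝ) : Measurable fun ω => f (Z (t + 1) ω) :=
  hnet.measurable_of_history (factorsThrough_step t fun _ z _ => f z)

lemma measurableSet_queue_feedback (hnet : IsMaxWeightNetwork H R₁ R₂ μ St Z B A Q) (t : ℕ)
    (y : QueueState × (Fin (t + 1 - 1) → Feedback)) :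
    MeasurableSet ((fun ω => (Q (t + 1) ω, pastFeedback Z (t + 1) ω)) ⁻¹' {y}) :=
  hnet.measurable_of_history (t := t) (β := Prop)
    (F := fun ω => (Q (t + 1) ω, pastFeedback Z (t + 1) ω) = y)
    (fun _ _ he => by simp only [hnet.factorsThrough_queue_feedback t he])
    (MeasurableSet.singleton True) |> fun h => by
      convert h using 1
      ext ω
      simp

/-- The weights that the policy compares are, up to the probability of the observation, the
integrals of the weights of the slot over the observation. -/
lemma setIntegral_slotWeight [IsFiniteMeasure μ]
    (hnet : IsMaxWeightNetwork H R₁ R₂ μ St Z B A Q) (t : ℕ) (ω₀ : Ω) (a : SlotAction) :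
    ∫ ω in (fun ω => (Q (t + 1) ω, pastFeedback Z (t + 1) ω)) ⁻¹'
        {(Q (t + 1) ω₀, pastFeedback Z (t + 1) ω₀)}, slotWeight (Q (t + 1) ω₀) a (Z (t + 1) ω) ∂μ =
      μ.real ((fun ω => (Q (t + 1) ω, pastFeedback Z (t + 1) ω)) ⁻¹'
        {(Q (t + 1) ω₀, pastFeedback Z (t + 1) ω₀)}) *
      actionWeight μ Z Q (t + 1) (Q (t + 1) ω₀) (pastFeedback Z (t + 1) ω₀) a := by
  have hset : {ω | Q (t + 1) ω = Q (t + 1) ω₀ ∧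
      pastFeedback Z (t + 1) ω = pastFeedback Z (t + 1) ω₀} =
      (fun ω => (Q (t + 1) ω, pastFeedback Z (t + 1) ω)) ⁻¹'
        {(Q (t + 1) ω₀, pastFeedback Z (t + 1) ω₀)} := by
    ext ω
    simp
  rw [actionWeight, hset]
  set T := (fun ω => (Q (t + 1) ω, pastFeedback Z (t + 1) ω)) ⁻¹'
        {(Q (t + 1) ω₀, pastFeedback Z (t + 1) ω₀)} with hT
  have hcap : ∀ j e, Integrable (fun ω => (capacity j e a (Z (t + 1) ω) : ℝ)) (μ.restrict T) :=
    fun j e => Integrable.mono' (integrable_const (1 : ℝ))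
      (hnet.measurable_capacity t fun z => (capacity j e a z : ℝ)).aestronglyMeasurable
      (ae_of_all _ fun ω => by
        rw [Real.norm_of_nonneg (Nat.cast_nonneg _)]
        exact_mod_cast capacity_le_one _ _ _ _)
  unfold slotWeight
  rw [integral_finsetSum _ fun j _ => integrable_finsetSum _ fun e _ => (hcap j e).const_mul _,
    Finset.mul_sum]
  refine Finset.sum_congr rfl fun j _ => ?_
  rw [integral_finsetSum _ fun e _ => (hcap j e).const_mul _, Finset.mul_sum]
  refine Finset.sum_congr rfl fun e _ => ?_
  rw [integral_const_mul, mul_left_comm]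
  refine congrArg (diffBacklog (Q (t + 1) ω₀) j e * ·) ?_
  rw [ProbabilityTheory.cond, integral_smul_measure, ENNReal.toReal_inv, smul_eq_mul, ← mul_assoc]
  by_cases h0 : μ T = 0
  · rw [Measure.restrict_eq_zero.2 h0]
    simp
  · rw [Measure.real, mul_inv_cancel₀ (ENNReal.toReal_ne_zero.2 ⟨h0, measure_ne_top _ _⟩), one_mul]

/-- The max-weight policy does at least as well as every randomized policy that knows only
the past feedback. -/
lemma integral_slotWeight_ge [IsFiniteMeasure μ]
    (hnet : IsMaxWeightNetwork H R₁ R₂ μ St Z B A Q) (t : ℕ) (p : Ω → SlotAction → ℝ)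
    (hp : Function.FactorsThrough p (pastFeedback Z (t + 1)))
    (hp0 : ∀ ω a, 0 ≤ p ω a) (hp1 : ∀ ω, ∑ a, p ω a = 1) :
    ∑ j, ∑ e, ∫ ω, diffBacklog (Q (t + 1) ω) j e * meanCapacity (p ω) j e (Z (t + 1) ω) ∂μ ≤
      ∫ ω, slotWeight (Q (t + 1) ω) (A (t + 1) ω) (Z (t + 1) ω) ∂μ := by
  have hpast : Function.FactorsThrough p (history St Z B Q t) := fun ω ω' he =>
    hp (congrArg Prod.snd (hnet.factorsThrough_queue_feedback t he))
  have hint : ∀ j e, Integrable (fun ω => diffBacklog (Q (t + 1) ω) j e *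
      meanCapacity (p ω) j e (Z (t + 1) ω)) μ := fun j e =>
    hnet.integrable_diffBacklog_mul_capacity t _ (fun ω ω' he => by
      have hz := factorsThrough_step t (fun _ z _ => z) he
      simp only at hz
      simp only [factorsThrough_history_mono (Nat.le_succ t) hpast he, hz])
      (fun ω => meanCapacity_nonneg (hp0 ω) _ _ _)
      (fun ω => meanCapacity_le_one (hp0 ω) (hp1 ω) _ _ _) j e
  simp only [← integral_finsetSum _ fun e _ => hint _ e]
  rw [← integral_finsetSum _ fun j _ => integrable_finsetSum _ fun e _ => hint j e]
  refine integral_le_of_atoms μ (hnet.measurableSet_queue_feedback t)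
    (integrable_finsetSum _ fun j _ => integrable_finsetSum _ fun e _ => hint j e)
    (hnet.integrable_slotWeight t _ (hnet.factorsThrough_action t)) fun ω₀ => ?_
  have hTm := hnet.measurableSet_queue_feedback t (Q (t + 1) ω₀, pastFeedback Z (t + 1) ω₀)
  have key := hnet.setIntegral_slotWeight t ω₀
  set T := (fun ω => (Q (t + 1) ω, pastFeedback Z (t + 1) ω)) ⁻¹'
        {(Q (t + 1) ω₀, pastFeedback Z (t + 1) ω₀)} with hT
  have hq : ∀ ω ∈ T, Q (t + 1) ω = Q (t + 1) ω₀ ∧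
      pastFeedback Z (t + 1) ω = pastFeedback Z (t + 1) ω₀ := fun ω hω => by
    simpa [hT] using hω
  have hr : ∫ ω in T, slotWeight (Q (t + 1) ω) (A (t + 1) ω) (Z (t + 1) ω) ∂μ =
      ∫ ω in T, slotWeight (Q (t + 1) ω₀) (A (t + 1) ω₀) (Z (t + 1) ω) ∂μ := by
    refine setIntegral_congr_fun hTm fun ω hω => ?_
    obtain ⟨φ, hφ⟩ := hnet.action_causal
    have hA : A (t + 1) ω = A (t + 1) ω₀ := by
      rw [hφ (t + 1) (by omega), hφ (t + 1) (by omega), (hq ω hω).1, (hq ω hω).2]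
    simp only [hA, (hq ω hω).1]
  have hl : ∫ ω in T, ∑ j, ∑ e, diffBacklog (Q (t + 1) ω) j e *
      meanCapacity (p ω) j e (Z (t + 1) ω) ∂μ =
      ∫ ω in T, ∑ a, p ω₀ a * slotWeight (Q (t + 1) ω₀) a (Z (t + 1) ω) ∂μ := by
    refine setIntegral_congr_fun hTm fun ω hω => ?_
    simp only [(hq ω hω).1, hp (hq ω hω).2, sum_mul_slotWeight]
  have hw : ∀ a, Integrable (fun ω => slotWeight (Q (t + 1) ω₀) a (Z (t + 1) ω))
      (μ.restrict T) := fun a =>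
    ((hnet.integrable_slotWeight t (fun _ => a) fun _ _ _ => rfl).restrict (s := T)).congr
      ((ae_restrict_mem hTm).mono fun ω hω => by simp only [(hq ω hω).1])
  rw [hr, hl, integral_finsetSum _ fun a _ => (hw a).const_mul _]
  simp only [integral_const_mul, key]
  calc ∑ a, p ω₀ a * (μ.real T * actionWeight μ Z Q (t + 1) (Q (t + 1) ω₀)
          (pastFeedback Z (t + 1) ω₀) a)
      ≤ ∑ a, p ω₀ a * (μ.real T * actionWeight μ Z Q (t + 1) (Q (t + 1) ω₀)
          (pastFeedback Z (t + 1) ω₀) (A (t + 1) ω₀)) :=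
        Finset.sum_le_sum fun a _ => mul_le_mul_of_nonneg_left
          (mul_le_mul_of_nonneg_left (hnet.action_max (t + 1) (by omega) ω₀ a)
            measureReal_nonneg) (hp0 ω₀ a)
    _ = _ := by rw [← Finset.sum_mul, hp1, one_mul]

end IsMaxWeightNetwork

lemma ErasureChannel.sum_feedbackProb_mul_mem_Icc {S : Type*} [Fintype S] [DecidableEq S]
    (H : ErasureChannel S) (k : ℕ) {r : (Fin k → Feedback) → ℝ} (h0 : ∀ z, 0 ≤ r z)
    (h1 : ∀ z, r z ≤ 1) : ∑ z, H.feedbackProb k z * r z ∈ Set.Icc (0 : ℝ) 1 := by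
  refine ⟨Finset.sum_nonneg fun z _ => mul_nonneg (H.feedbackProb_nonneg k z) (h0 z), ?_⟩
  rw [← H.sum_feedbackProb k]
  exact Finset.sum_le_sum fun z _ => mul_le_of_le_one_right (H.feedbackProb_nonneg k z) (h1 z)

lemma totalBacklog_nonneg (q : QueueState) : 0 ≤ totalBacklog q :=
  Finset.sum_nonneg fun _ _ => Finset.sum_nonneg fun _ _ => Nat.cast_nonneg _

lemma le_totalBacklog (q : QueueState) (j : Fin 2) (l : Buffer) :
    (q j l : ℝ) ≤ totalBacklog q :=
  (Finset.single_le_sum (f := fun l => (q j l : ℝ)) (fun _ _ => Nat.cast_nonneg _)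
    (Finset.mem_univ l)).trans
    (Finset.single_le_sum (f := fun j => ∑ l, (q j l : ℝ))
      (fun _ _ => Finset.sum_nonneg fun _ _ => Nat.cast_nonneg _) (Finset.mem_univ j))

lemma sqBacklog_ge (a : ℝ) (q : QueueState) :
    2 * a * totalBacklog q - 6 * a ^ 2 ≤ sqBacklog q := by
  have h : 0 ≤ ∑ j : Fin 2, ∑ l : Buffer, ((q j l : ℝ) - a) ^ 2 :=
    Finset.sum_nonneg fun _ _ => Finset.sum_nonneg fun _ _ => sq_nonneg _
  simp only [totalBacklog, sqBacklog, Buffer.sum_univ, Fin.sum_univ_two] at h ⊢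
  linarith

namespace IsMaxWeightNetwork

variable {S : Type*} [Fintype S] [DecidableEq S] {H : ErasureChannel S} {R₁ R₂ : ℝ}
  {Ω : Type*} [MeasurableSpace Ω] {μ : Measure Ω}
  {St : ℕ → Ω → S} {Z : ℕ → Ω → Feedback} {B : ℕ → Ω → Fin 2 → Bool}
  {A : ℕ → Ω → SlotAction} {Q : ℕ → Ω → QueueState}

/-! ### Averaging over the channel -/

lemma abs_diffBacklog_queue_sub_le (hnet : IsMaxWeightNetwork H R₁ R₂ μ St Z B A Q) (t k : ℕ)
    (ω : Ω) (j : Fin 2) (e : Link) :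
    |diffBacklog (Q (t + 1 + k) ω) j e - diffBacklog (Q (t + 1) ω) j e| ≤ 4 * k := by
  have := abs_diffBacklog_sub_le _ _ _ (fun j l => hnet.abs_queue_sub_le t k ω j l) j e
  linarith

lemma integral_diffBacklog_sub_le [IsProbabilityMeasure μ]
    (hnet : IsMaxWeightNetwork H R₁ R₂ μ St Z B A Q) (t k : ℕ) (j : Fin 2) (e : Link) :
    ∫ ω, diffBacklog (Q (t + 1 + k) ω) j e ∂μ ≤ ∫ ω, diffBacklog (Q (t + 1) ω) j e ∂μ + 4 * k := by
  have h : ∫ ω, diffBacklog (Q (t + 1 + k) ω) j e ∂μ ≤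
      ∫ ω, (diffBacklog (Q (t + 1) ω) j e + 4 * k) ∂μ := by
    refine integral_mono (by rw [add_right_comm]; exact hnet.integrable_diffBacklog (t + k) j e)
      ((hnet.integrable_diffBacklog t j e).add (integrable_const _)) fun ω => ?_
    have := (abs_le.1 (hnet.abs_diffBacklog_queue_sub_le t k ω j e)).2
    simp only
    linarith
  rwa [integral_add (hnet.integrable_diffBacklog t j e) (integrable_const _), integral_const,
    probReal_univ, one_smul] at h

/-- A function `r` of a window of `k` feedback samples may be replaced by its steady-state
expectation, up to a bounded error and the increment of a function that is bounded by a multiple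
of the mean backlog. The error of the averaging is `g - P g` for a solution `g` of the Poisson
equation, and `D(Q) (g - P g)` has, up to bounded terms, the expectation of an increment of
`D(Q) g`, since the backlog `D(Q)` changes by a bounded amount in a slot. -/
lemma exists_window_average [IsProbabilityMeasure μ]
    (hnet : IsMaxWeightNetwork H R₁ R₂ μ St Z B A Q)
    (h1 : 0 ≤ R₁ ∧ R₁ ≤ 1) (h2 : 0 ≤ R₂ ∧ R₂ ≤ 1) (k : ℕ) {r : (Fin (k + 1) → Feedback) → ℝ}
    (hr0 : ∀ z, 0 ≤ r z) (hr1 : ∀ z, r z ≤ 1) (j : Fin 2) (e : Link) :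
    ∃ (C G : ℝ) (Ψ : ℕ → ℝ), 0 ≤ G ∧
      (∀ t, |Ψ t| ≤ G * ∫ ω, totalBacklog (Q (t + 1) ω) ∂μ) ∧
      ∀ t, (∑ z, H.feedbackProb (k + 1) z * r z) * ∫ ω, diffBacklog (Q (t + 1 + k) ω) j e ∂μ +
        Ψ t - Ψ (t + 1) - C ≤
        ∫ ω, diffBacklog (Q (t + 1 + k) ω) j e * r (fun i => Z (t + 1 + i) ω) ∂μ := by
  obtain ⟨g, hg⟩ := H.exists_poisson (H.obsExp (k + 1) r)
  rw [H.sum_π_mul_obsExp] at hg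
  have hρ := H.sum_feedbackProb_mul_mem_Icc (k + 1) hr0 hr1
  set ρ := ∑ z, H.feedbackProb (k + 1) z * r z with hρdef
  obtain ⟨G, hG⟩ := (Set.finite_range fun s => |g s|).bddAbove
  have hG' : ∀ s, |g s| ≤ G := fun s => hG ⟨s, rfl⟩
  have hS : Nonempty S := by
    by_contra h
    rw [not_nonempty_iff] at h
    simpa using H.sum_π
  have hG0 : 0 ≤ G := (abs_nonneg _).trans (hG' hS.some)
  have hD : ∀ t, Function.FactorsThrough (fun ω => diffBacklog (Q (t + 1) ω) j e)
      (history St Z B Q t) := fun t _ _ he => by simp only [hnet.factorsThrough_queue t he]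
  have hDi := fun t => hnet.integrable_diffBacklog t j e
  have hDg : ∀ t, Integrable (fun ω => diffBacklog (Q (t + 1) ω) j e * g (St t ω)) μ := fun t =>
    hnet.integrable_mul_of_history (hDi t) (factorsThrough_state t g) fun ω => hG' _
  have hDg' : ∀ t, Integrable (fun ω => diffBacklog (Q (t + 1) ω) j e * g (St (t + 1) ω)) μ :=
    fun t => hnet.integrable_mul_of_history (hDi t) (factorsThrough_state (t + 1) g)
      fun ω => hG' _
  have hDP : ∀ t, Integrable (fun ω => diffBacklog (Q (t + 1) ω) j e *
      ∑ s, H.P (St t ω) s * g s) μ := fun t => by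
    obtain ⟨C, hC⟩ := (Set.finite_range fun x => |∑ s, H.P x s * g s|).bddAbove
    exact hnet.integrable_mul_of_history (hDi t)
      (factorsThrough_state t fun x => ∑ s, H.P x s * g s) fun ω => hC ⟨_, rfl⟩
  have hwf : ∀ t, Function.FactorsThrough (fun ω => r (fun i => Z (t + 1 + i) ω))
      (history St Z B Q (t + 1 + k)) := by
    intro t ω ω' he
    have : (fun i : Fin (k + 1) => Z (t + 1 + i) ω) = fun i : Fin (k + 1) => Z (t + 1 + i) ω' :=
      funext fun i => ((history_eq_iff.1 he).2.2 _
        (Finset.mem_Icc.2 ⟨by omega, by omega⟩)).2.1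
    simp only [this]
  have hr : ∀ z, |r z| ≤ 1 := fun z => abs_le.2 ⟨by linarith [hr0 z], hr1 z⟩
  have hwi : ∀ t, Integrable (fun ω => diffBacklog (Q (t + 1) ω) j e *
      r (fun i => Z (t + 1 + i) ω)) μ := fun t =>
    hnet.integrable_mul_of_history (hDi t) (hwf t) fun ω => hr _
  have hwi' : ∀ t, Integrable (fun ω => diffBacklog (Q (t + 1 + k) ω) j e *
      r (fun i => Z (t + 1 + i) ω)) μ := fun t =>
    hnet.integrable_mul_of_history
      (by rw [add_right_comm]; exact hDi (t + k)) (hwf t) fun ω => hr _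
  refine ⟨8 * k + 4 * G, G, fun t => ∫ ω, diffBacklog (Q (t + 1) ω) j e * g (St t ω) ∂μ, hG0,
    fun t => ?_, fun t => ?_⟩
  · refine abs_integral_le_integral_abs.trans ?_
    rw [← integral_const_mul]
    refine integral_mono (hDg t).abs ((hnet.integrable_totalBacklog t).const_mul G) fun ω => ?_
    simp only [abs_mul, abs_of_nonneg (diffBacklog_nonneg _ _ _)]
    rw [mul_comm G]
    exact mul_le_mul ((diffBacklog_le _ _ _).trans (le_totalBacklog _ _ _)) (hG' _)
      (abs_nonneg _) (totalBacklog_nonneg _)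
  · have s1 : ∫ ω, diffBacklog (Q (t + 1) ω) j e * r (fun i => Z (t + 1 + i) ω) ∂μ - 4 * k ≤
        ∫ ω, diffBacklog (Q (t + 1 + k) ω) j e * r (fun i => Z (t + 1 + i) ω) ∂μ := by
      have h : ∫ ω, diffBacklog (Q (t + 1) ω) j e * r (fun i => Z (t + 1 + i) ω) ∂μ ≤
          ∫ ω, (diffBacklog (Q (t + 1 + k) ω) j e * r (fun i => Z (t + 1 + i) ω) + 4 * k) ∂μ := by
        refine integral_mono (hwi t) ((hwi' t).add (integrable_const _)) fun ω => ?_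
        have a1 := (abs_le.1 (hnet.abs_diffBacklog_queue_sub_le t k ω j e)).1
        have a2 : (0 : ℝ) ≤ 4 * k := by positivity
        simp only
        nlinarith [hr0 (fun i => Z (t + 1 + i) ω), hr1 (fun i => Z (t + 1 + i) ω)]
      rw [integral_add (hwi' t) (integrable_const _), integral_const, probReal_univ,
        one_smul] at h
      linarith
    have s2 : ∫ ω, diffBacklog (Q (t + 1) ω) j e * r (fun i => Z (t + 1 + i) ω) ∂μ =
        ρ * ∫ ω, diffBacklog (Q (t + 1) ω) j e ∂μ +
        ∫ ω, diffBacklog (Q (t + 1) ω) j e * g (St t ω) ∂μ -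
        ∫ ω, diffBacklog (Q (t + 1) ω) j e * g (St (t + 1) ω) ∂μ := by
      have hsum : Integrable (fun ω => ρ * diffBacklog (Q (t + 1) ω) j e +
          diffBacklog (Q (t + 1) ω) j e * g (St t ω)) μ := ((hDi t).const_mul ρ).add (hDg t)
      rw [hnet.integral_mul_window h1 h2 (k + 1) t (hDi t) (hD t) r,
        hnet.integral_mul_state_step h1 h2 t (hDi t) (hD t) g, ← integral_const_mul,
        ← integral_add ((hDi t).const_mul ρ) (hDg t),
        ← integral_sub hsum (hDP t)]
      refine integral_congr_ae (ae_of_all _ fun ω => ?_)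
      simp only [hg (St t ω)]
      ring
    have s3 : ∫ ω, diffBacklog (Q (t + 1) ω) j e * g (St (t + 1) ω) ∂μ ≤
        ∫ ω, diffBacklog (Q (t + 1 + 1) ω) j e * g (St (t + 1) ω) ∂μ + 4 * G := by
      have h : ∫ ω, diffBacklog (Q (t + 1) ω) j e * g (St (t + 1) ω) ∂μ ≤
          ∫ ω, (diffBacklog (Q (t + 1 + 1) ω) j e * g (St (t + 1) ω) + 4 * G) ∂μ := by
        refine integral_mono (hDg' t) ((hDg (t + 1)).add (integrable_const _)) fun ω => ?_
        have a1 := hnet.abs_diffBacklog_queue_sub_le t 1 ω j e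
        have a2 : |(diffBacklog (Q (t + 1 + 1) ω) j e - diffBacklog (Q (t + 1) ω) j e) *
            g (St (t + 1) ω)| ≤ 4 * (1 : ℕ) * G := by
          rw [abs_mul]
          exact mul_le_mul a1 (hG' _) (abs_nonneg _) (by positivity)
        have a3 := (abs_le.1 a2).1
        push_cast at a3
        simp only
        linarith
      rwa [integral_add (hDg (t + 1)) (integrable_const _), integral_const, probReal_univ,
        one_smul] at h
    have s4 : ρ * ∫ ω, diffBacklog (Q (t + 1 + k) ω) j e ∂μ ≤
        ρ * ∫ ω, diffBacklog (Q (t + 1) ω) j e ∂μ + 4 * k := by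
      have a1 := mul_le_mul_of_nonneg_left (hnet.integral_diffBacklog_sub_le t k j e) hρ.1
      have a2 : ρ * (4 * (k : ℝ)) ≤ 1 * (4 * k) :=
        mul_le_mul_of_nonneg_right hρ.2 (by positivity)
      linarith
    simp only
    linarith

/-! ### Drift of the mean backlog -/

/-- The drift of the quadratic Lyapunov function in a slot. -/
lemma integral_sqBacklog_succ_le [IsProbabilityMeasure μ]
    (hnet : IsMaxWeightNetwork H R₁ R₂ μ St Z B A Q)
    (h1 : 0 ≤ R₁ ∧ R₁ ≤ 1) (h2 : 0 ≤ R₂ ∧ R₂ ≤ 1) (t : ℕ) :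
    ∫ ω, sqBacklog (Q (t + 1 + 1) ω) ∂μ ≤ ∫ ω, sqBacklog (Q (t + 1) ω) ∂μ + 24 +
      2 * ∑ j, ![R₁, R₂] j * ∫ ω, (Q (t + 1) ω j .one : ℝ) ∂μ -
      2 * ∫ ω, slotWeight (Q (t + 1) ω) (A (t + 1) ω) (Z (t + 1) ω) ∂μ := by
  have hB : ∀ j, Integrable (fun ω => (Q (t + 1) ω j .one : ℝ) *
      (if B (t + 1) ω j = true then 1 else 0)) μ := fun j =>
    hnet.integrable_mul_of_history (hnet.integrable_queue t j .one)
      (factorsThrough_step t fun _ _ b => if b j = true then (1 : ℝ) else 0) (C := 1)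
      fun ω => by split_ifs <;> simp
  have hBs := integrable_finsetSum Finset.univ fun j _ => hB j
  have hW := hnet.integrable_slotWeight t _ (hnet.factorsThrough_action t)
  have hV := hnet.integrable_sqBacklog t
  have hV' : Integrable (fun ω => sqBacklog (Q (t + 1) ω) + 24) μ := hV.add (integrable_const _)
  have hV'' : Integrable (fun ω => sqBacklog (Q (t + 1) ω) + 24 + 2 * ∑ j,
      (Q (t + 1) ω j .one : ℝ) * (if B (t + 1) ω j = true then 1 else 0)) μ :=
    hV'.add (hBs.const_mul 2)
  have h : ∫ ω, sqBacklog (Q (t + 1 + 1) ω) ∂μ ≤ ∫ ω, (sqBacklog (Q (t + 1) ω) + 24 +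
      2 * ∑ j, (Q (t + 1) ω j .one : ℝ) * (if B (t + 1) ω j = true then 1 else 0) -
      2 * slotWeight (Q (t + 1) ω) (A (t + 1) ω) (Z (t + 1) ω)) ∂μ := by
    refine integral_mono (hnet.integrable_sqBacklog (t + 1))
      (hV''.sub (hW.const_mul 2)) fun ω => ?_
    simp only
    rw [hnet.queue_next (t + 1) (by omega)]
    exact sqBacklog_nextState_le _ _ _ _
  rw [integral_sub hV'' (hW.const_mul 2), integral_add hV' (hBs.const_mul 2),
    integral_add hV (integrable_const _), integral_const, probReal_univ, one_smul,
    integral_const_mul, integral_const_mul, integral_finsetSum _ fun j _ => hB j] at h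
  refine h.trans (le_of_eq ?_)
  congr 3
  refine Finset.sum_congr rfl fun j _ => hnet.integral_mul_arrival h1 h2 t
    (hnet.integrable_queue t j .one) (fun _ _ he => by
      simp only [hnet.factorsThrough_queue t he]) j

end IsMaxWeightNetwork

lemma abs_totalBacklog_sub_le (q q' : QueueState) (c : ℝ)
    (h : ∀ j l, |(q j l : ℝ) - q' j l| ≤ c) : |totalBacklog q - totalBacklog q'| ≤ 6 * c := by
  have h' := fun j l => abs_le.1 (h j l)
  simp only [totalBacklog, Buffer.sum_univ, Fin.sum_univ_two]
  rw [abs_le]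
  constructor
  · linarith [(h' 0 .one).1, (h' 0 .two).1, (h' 0 .three).1, (h' 1 .one).1, (h' 1 .two).1,
      (h' 1 .three).1]
  · linarith [(h' 0 .one).2, (h' 0 .two).2, (h' 0 .three).2, (h' 1 .one).2, (h' 1 .two).2,
      (h' 1 .three).2]

lemma ErasureChannel.slotExp_eq_sum_window {S : Type*} [Fintype S] [DecidableEq S]
    (H : ErasureChannel S) (n : ℕ) (f : (k : ℕ) → (Fin k → Feedback) → Feedback → ℝ) :
    H.slotExp n f = (1 / (n : ℝ)) * ∑ k ∈ Finset.range n, ∑ z : Fin (k + 1) → Feedback,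
      H.feedbackProb (k + 1) z * f k (Fin.init z) (z (Fin.last k)) := by
  rw [slotExp_apply]
  refine congrArg _ (Finset.sum_congr rfl fun k _ => ?_)
  rw [Fintype.sum_fin_snoc (α := Feedback) k]
  simp only [Fin.init_snoc, Fin.snoc_last]

/-- A Lyapunov drift with a correction `U` that is dominated by the Lyapunov function `V` bounds
the averages of `X`. -/
lemma exists_sum_le_of_drift {X V U : ℕ → ℝ} {n : ℕ} {C ε K : ℝ} (hε : 0 < ε)
    (hX : ∀ t, 0 ≤ X t) (hU : ∀ t, U t - V t ≤ K)
    (hd : ∀ t, V (t + 1) + ε * X (t + n) ≤ V t + C + U (t + 1) - U t) :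
    ∃ M : ℝ, 0 ≤ M ∧ ∀ N : ℕ, 1 ≤ N → ∑ t ∈ Finset.range N, X t ≤ M * N := by
  have hsum : ∀ m : ℕ, ε * ∑ i ∈ Finset.range m, X (n + i) ≤
      (V 0 - U 0) - (V m - U m) + C * m := by
    intro m
    induction m with
    | zero => simp
    | succ m ih =>
      rw [Finset.sum_range_succ, mul_add, add_comm n m]
      have := hd m
      push_cast
      linarith
  set K₀ := ∑ i ∈ Finset.range n, X i + |(V 0 - U 0 + K)| / ε with hK₀
  have hK₀0 : 0 ≤ K₀ := add_nonneg (Finset.sum_nonneg fun i _ => hX i) (by positivity)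
  refine ⟨K₀ + |C| / ε, add_nonneg hK₀0 (by positivity), fun N hN => ?_⟩
  have hN' : (1 : ℝ) ≤ N := by exact_mod_cast hN
  have e1 : ∑ t ∈ Finset.range N, X t ≤
      ∑ t ∈ Finset.range n, X t + ∑ i ∈ Finset.range N, X (n + i) := by
    rw [← Finset.sum_range_add]
    exact Finset.sum_le_sum_of_subset_of_nonneg (Finset.range_mono (by omega)) fun i _ _ => hX i
  have e2 : ∑ i ∈ Finset.range N, X (n + i) ≤ |(V 0 - U 0 + K)| / ε + |C| / ε * N := by
    rw [div_mul_eq_mul_div, ← add_div, le_div_iff₀ hε, mul_comm]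
    have a1 := hsum N
    have a2 := hU N
    have a3 := le_abs_self (V 0 - U 0 + K)
    have a4 : C * N ≤ |C| * N := mul_le_mul_of_nonneg_right (le_abs_self C) (by linarith)
    linarith
  have e3 : K₀ * 1 ≤ K₀ * N := mul_le_mul_of_nonneg_left hN' hK₀0
  linarith

namespace IsMaxWeightNetwork

variable {S : Type*} [Fintype S] [DecidableEq S] {H : ErasureChannel S} {R₁ R₂ : ℝ}
  {Ω : Type*} [MeasurableSpace Ω] {μ : Measure Ω}
  {St : ℕ → Ω → S} {Z : ℕ → Ω → Feedback} {B : ℕ → Ω → Fin 2 → Bool}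
  {A : ℕ → Ω → SlotAction} {Q : ℕ → Ω → QueueState}

lemma integral_totalBacklog_le [IsProbabilityMeasure μ]
    (hnet : IsMaxWeightNetwork H R₁ R₂ μ St Z B A Q) (t k : ℕ) :
    ∫ ω, totalBacklog (Q (t + 1) ω) ∂μ ≤ ∫ ω, totalBacklog (Q (t + k + 1) ω) ∂μ + 12 * k := by
  have h : ∫ ω, totalBacklog (Q (t + 1) ω) ∂μ ≤
      ∫ ω, (totalBacklog (Q (t + k + 1) ω) + 12 * k) ∂μ := by
    refine integral_mono (hnet.integrable_totalBacklog t)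
      ((hnet.integrable_totalBacklog (t + k)).add (integrable_const _)) fun ω => ?_
    have := (abs_le.1 (abs_totalBacklog_sub_le _ _ _
      fun j l => hnet.abs_queue_sub_le t k ω j l)).1
    rw [add_right_comm t 1 k] at this
    simp only
    linarith
  rwa [integral_add (hnet.integrable_totalBacklog (t + k)) (integrable_const _), integral_const,
    probReal_univ, one_smul] at h

/-- The max-weight policy does at least as well as a randomized policy that uses the last `k`
feedback samples. -/
lemma sum_integral_window_le [IsProbabilityMeasure μ]
    (hnet : IsMaxWeightNetwork H R₁ R₂ μ St Z B A Q) (t k : ℕ)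
    (p : (Fin k → Feedback) → SlotAction → ℝ) (hp0 : ∀ z a, 0 ≤ p z a)
    (hp1 : ∀ z, ∑ a, p z a = 1) :
    ∑ j, ∑ e, ∫ ω, diffBacklog (Q (t + 1 + k) ω) j e *
        meanCapacity (p fun i => Z (t + 1 + i) ω) j e (Z (t + 1 + k) ω) ∂μ ≤
      ∫ ω, slotWeight (Q (t + k + 1) ω) (A (t + k + 1) ω) (Z (t + k + 1) ω) ∂μ := by
  rw [add_right_comm t 1 k]
  refine hnet.integral_slotWeight_ge (t + k) (fun ω => p fun i => Z (t + 1 + i) ω)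
    (fun ω ω' he => ?_) (fun ω a => hp0 _ a) (fun ω => hp1 _)
  have : (fun i : Fin k => Z (t + 1 + i) ω) = fun i : Fin k => Z (t + 1 + i) ω' := by
    ext1 i
    have := congrFun he ⟨t + i, by omega⟩
    rw [add_right_comm t 1]
    exact this
  simp only [this]

/-- The drift of the mean quadratic backlog, compared with the policy `pol`, which uses
the last `k` feedback samples for a uniformly distributed `k < n`. -/
lemma exists_drift [IsProbabilityMeasure μ]
    (hnet : IsMaxWeightNetwork H R₁ R₂ μ St Z B A Q)
    (h1 : 0 ≤ R₁ ∧ R₁ ≤ 1) (h2 : 0 ≤ R₂ ∧ R₂ ≤ 1) {n : ℕ} (hn : 0 < n)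
    (pol : ∀ k : ℕ, (Fin k → Feedback) → SlotAction → ℝ)
    (hp0 : ∀ k z a, 0 ≤ pol k z a) (hp1 : ∀ k z, ∑ a, pol k z a = 1) {ε : ℝ}
    (hε : ∀ q : QueueState, ∑ j, ![R₁, R₂] j * (q j .one : ℝ) + ε * totalBacklog q ≤
      ∑ j, ∑ e, diffBacklog q j e * H.slotExp n (fun k z w => meanCapacity (pol k z) j e w)) :
    ∃ (C G : ℝ) (U : ℕ → ℝ),
      (∀ t, U t ≤ G * (∫ ω, totalBacklog (Q (t + n + 1) ω) ∂μ + 12 * n)) ∧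
      ∀ t, ∫ ω, sqBacklog (Q (t + n + 1 + 1) ω) ∂μ +
          2 * ε * ∫ ω, totalBacklog (Q (t + n + 1) ω) ∂μ ≤
        ∫ ω, sqBacklog (Q (t + n + 1) ω) ∂μ + C + U (t + 1) - U t := by
  have hwin := fun (k : ℕ) (j : Fin 2) (e : Link) => hnet.exists_window_average h1 h2 k
    (r := fun z => meanCapacity (pol k (Fin.init z)) j e (z (Fin.last k)))
    (fun z => meanCapacity_nonneg (hp0 k _) _ _ _)
    (fun z => meanCapacity_le_one (hp0 k _) (hp1 k _) _ _ _) j e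
  choose C G Ψ hG hΨ hav using hwin
  have hn' : (0 : ℝ) < n := by exact_mod_cast hn
  refine ⟨24 + 2 / n * ∑ k ∈ Finset.range n, ∑ j, ∑ e, C k j e,
    2 / n * ∑ k ∈ Finset.range n, ∑ j, ∑ e, G k j e,
    fun t => 2 / n * ∑ k ∈ Finset.range n, ∑ j, ∑ e, Ψ k j e (t + n - k), fun t => ?_,
    fun t => ?_⟩
  · rw [mul_assoc]
    refine mul_le_mul_of_nonneg_left ?_ (by positivity)
    rw [Finset.sum_mul]
    refine Finset.sum_le_sum fun k hk => ?_
    rw [Finset.sum_mul]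
    refine Finset.sum_le_sum fun j _ => ?_
    rw [Finset.sum_mul]
    refine Finset.sum_le_sum fun e _ => ?_
    rw [Finset.mem_range] at hk
    refine (le_abs_self _).trans ((hΨ k j e _).trans (mul_le_mul_of_nonneg_left ?_ (hG k j e)))
    have a1 := hnet.integral_totalBacklog_le (t + n - k) k
    rw [show t + n - k + k = t + n by omega] at a1
    have a2 : (k : ℝ) ≤ n := by exact_mod_cast hk.le
    linarith
  · set D : Fin 2 → Link → ℝ := fun j e => ∫ ω, diffBacklog (Q (t + n + 1) ω) j e ∂μ with hD
    set W := ∫ ω, slotWeight (Q (t + n + 1) ω) (A (t + n + 1) ω) (Z (t + n + 1) ω) ∂μ with hW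
    set c : Fin 2 → Link → ℝ := fun j e =>
      H.slotExp n (fun k z w => meanCapacity (pol k z) j e w) with hc
    set ρ : ℕ → Fin 2 → Link → ℝ := fun k j e => ∑ z : Fin (k + 1) → Feedback,
      H.feedbackProb (k + 1) z * meanCapacity (pol k (Fin.init z)) j e (z (Fin.last k)) with hρ
    have hk : ∀ k ∈ Finset.range n, ∑ j, ∑ e, (ρ k j e * D j e + Ψ k j e (t + n - k) -
        Ψ k j e (t + 1 + n - k) - C k j e) ≤ W := by
      intro k hk
      rw [Finset.mem_range] at hk
      have hb := hnet.sum_integral_window_le (t + n - k) k (pol k) (hp0 k) (hp1 k)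
      rw [show t + n - k + k + 1 = t + n + 1 by omega] at hb
      refine le_trans (Finset.sum_le_sum fun j _ => Finset.sum_le_sum fun e _ => ?_) hb
      have ha := hav k j e (t + n - k)
      rw [show t + n - k + 1 + k = t + n + 1 by omega] at ha ⊢
      rw [show t + 1 + n - k = t + n - k + 1 by omega]
      refine ha.trans (le_of_eq ?_)
      refine integral_congr_ae (ae_of_all _ fun ω => ?_)
      simp only [Fin.val_last]
      rw [show t + n - k + 1 + k = t + n + 1 by omega]
      rfl
    have hsum := Finset.sum_le_sum hk
    rw [Finset.sum_const, Finset.card_range, nsmul_eq_mul] at hsum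
    simp only [Finset.sum_add_distrib, Finset.sum_sub_distrib] at hsum
    have hρc : ∑ k ∈ Finset.range n, ∑ j, ∑ e, ρ k j e * D j e =
        n * ∑ j, ∑ e, c j e * D j e := by
      rw [Finset.sum_comm, Finset.mul_sum]
      refine Finset.sum_congr rfl fun j _ => ?_
      rw [Finset.sum_comm, Finset.mul_sum]
      refine Finset.sum_congr rfl fun e _ => ?_
      rw [← Finset.sum_mul, hc, ← mul_assoc]
      simp only [ErasureChannel.slotExp_eq_sum_window]
      rw [← mul_assoc, mul_one_div_cancel hn'.ne', one_mul]
    have hcD : ∑ j, ![R₁, R₂] j * ∫ ω, (Q (t + n + 1) ω j .one : ℝ) ∂μ +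
        ε * ∫ ω, totalBacklog (Q (t + n + 1) ω) ∂μ ≤ ∑ j, ∑ e, c j e * D j e := by
      have i1 : ∀ j, Integrable (fun ω => ![R₁, R₂] j * (Q (t + n + 1) ω j .one : ℝ)) μ :=
        fun j => (hnet.integrable_queue (t + n) j .one).const_mul _
      have i2 : Integrable (fun ω => ε * totalBacklog (Q (t + n + 1) ω)) μ :=
        (hnet.integrable_totalBacklog (t + n)).const_mul _
      have i3 : ∀ j e, Integrable (fun ω => diffBacklog (Q (t + n + 1) ω) j e * c j e) μ :=
        fun j e => (hnet.integrable_diffBacklog (t + n) j e).mul_const _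
      have h := integral_mono ((integrable_finsetSum _ fun j _ => i1 j).add i2)
        (integrable_finsetSum _ fun j _ => integrable_finsetSum _ fun e _ => i3 j e)
        fun ω => hε (Q (t + n + 1) ω)
      simp only [Pi.add_apply] at h
      rw [integral_add (integrable_finsetSum _ fun j _ => i1 j) i2,
        integral_finsetSum _ fun j _ => i1 j, integral_const_mul,
        integral_finsetSum _ fun j _ => integrable_finsetSum _ fun e _ => i3 j e] at h
      simp only [integral_const_mul] at h
      refine h.trans (le_of_eq (Finset.sum_congr rfl fun j _ => ?_))
      rw [integral_finsetSum _ fun e _ => i3 j e]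
      exact Finset.sum_congr rfl fun e _ => by rw [integral_mul_const, mul_comm]
    have hV := hnet.integral_sqBacklog_succ_le h1 h2 (t + n)
    rw [← hW] at hV
    rw [hρc] at hsum
    have hdiv := mul_le_mul_of_nonneg_left hsum (show 0 ≤ 2 / (n : ℝ) by positivity)
    have e1 : 2 / (n : ℝ) * (n * W) = 2 * W := by field_simp
    have e2 : 2 / (n : ℝ) * (n * ∑ j, ∑ e, c j e * D j e) = 2 * ∑ j, ∑ e, c j e * D j e := by
      field_simp
    rw [e1, mul_sub, mul_sub, mul_add, e2] at hdiv
    linarith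

end IsMaxWeightNetwork

theorem mainTheorem4 {S : Type*} [Fintype S] [DecidableEq S] (H : ErasureChannel S)
    {Ω : Type*} [MeasurableSpace Ω] (μ : Measure Ω) [IsProbabilityMeasure μ]
    (R₁ R₂ δ : ℝ) (hR₁ : 0 ≤ R₁) (hR₂ : 0 ≤ R₂) (hδ : 0 < δ)
    (hR : (R₁ + δ, R₂ + δ) ∈ H.outerRegion)
    (St : ℕ → Ω → S) (Z : ℕ → Ω → Feedback) (B : ℕ → Ω → Fin 2 → Bool)
    (A : ℕ → Ω → SlotAction) (Q : ℕ → Ω → QueueState)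
    (hnet : IsMaxWeightNetwork H R₁ R₂ μ St Z B A Q) :
    ∀ (j : Fin 2) (l : Buffer), StronglyStable μ (fun t ω => Q t ω j l) := by
  obtain ⟨hR1, n, hn, pol, hp0, hp1, ε, hε0, hε⟩ := H.exists_policy ![R₁, R₂]
    (fun j => by fin_cases j <;> assumption) δ hδ hR
  obtain ⟨C, G, U, hU, hd⟩ := hnet.exists_drift ⟨hR₁, hR1 0⟩ ⟨hR₂, hR1 1⟩ hn pol hp0 hp1 hε
  have hX0 : ∀ t, 0 ≤ ∫ ω, totalBacklog (Q (t + 1) ω) ∂μ := fun t =>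
    integral_nonneg fun ω => totalBacklog_nonneg _
  obtain ⟨M, hM0, hM⟩ := exists_sum_le_of_drift
    (X := fun t => ∫ ω, totalBacklog (Q (t + 1) ω) ∂μ)
    (V := fun t => ∫ ω, sqBacklog (Q (t + n + 1) ω) ∂μ) (U := U) (n := n) (C := C)
    (ε := 2 * ε) (K := G * (12 * n) + 6 * (G / 2) ^ 2) (by positivity) hX0
    (fun t => by
      have h := integral_mono (((hnet.integrable_totalBacklog (t + n)).const_mul
        (2 * (G / 2))).sub (integrable_const (6 * (G / 2) ^ 2)))
        (hnet.integrable_sqBacklog (t + n)) fun ω => sqBacklog_ge (G / 2) (Q (t + n + 1) ω)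
      simp only [Pi.sub_apply] at h
      rw [integral_sub ((hnet.integrable_totalBacklog (t + n)).const_mul _)
        (integrable_const _), integral_const, probReal_univ, one_smul, integral_const_mul] at h
      have := hU t
      linarith)
    (fun t => by
      have := hd t
      rw [show t + 1 + n + 1 = t + n + 1 + 1 by omega]
      exact this)
  intro j l
  have key : ∀ N : ℕ, 1 ≤ N → (∑ t ∈ Finset.Icc 1 N, ∫⁻ ω, (Q t ω j l : ENNReal) ∂μ) /
      (N : ENNReal) ≤ ENNReal.ofReal M := by
    intro N hN
    refine ENNReal.div_le_of_le_mul ?_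
    have e1 : ∑ t ∈ Finset.Icc 1 N, ∫⁻ ω, (Q t ω j l : ENNReal) ∂μ =
        ∑ t ∈ Finset.range N, ∫⁻ ω, (Q (t + 1) ω j l : ENNReal) ∂μ := by
      rw [Finset.range_eq_Ico, Finset.sum_Ico_add' (fun t => ∫⁻ ω, (Q t ω j l : ENNReal) ∂μ)]
      rfl
    have e2 : ∀ t, ∫⁻ ω, (Q (t + 1) ω j l : ENNReal) ∂μ ≤
        ENNReal.ofReal (∫ ω, totalBacklog (Q (t + 1) ω) ∂μ) := by
      intro t
      rw [ofReal_integral_eq_lintegral_ofReal (hnet.integrable_totalBacklog t)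
        (ae_of_all _ fun ω => totalBacklog_nonneg _)]
      refine lintegral_mono fun ω => ?_
      rw [← ENNReal.ofReal_natCast]
      exact ENNReal.ofReal_le_ofReal (le_totalBacklog _ j l)
    rw [e1]
    refine (Finset.sum_le_sum fun t _ => e2 t).trans ?_
    rw [← ENNReal.ofReal_sum_of_nonneg fun t _ => hX0 t, ← ENNReal.ofReal_natCast,
      ← ENNReal.ofReal_mul hM0]
    exact ENNReal.ofReal_le_ofReal (hM N hN)
  unfold StronglyStable
  refine lt_of_le_of_lt (limsup_le_of_le (a := ENNReal.ofReal M) (by isBoundedDefault) ?_)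
    ENNReal.ofReal_lt_top
  filter_upwards [eventually_ge_atTop 1] with N hN using key N hN
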